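/- Let $(\Omega,\mathcal B,\mathbf P)$ be a probability space, $T:\Omega\to\Omega$ an invertible (bimeasurable) measure-preserving ergodic transformation, $\mathcal Y\subseteq\mathcal B$ a $\sigma$-field, and $(U,\mathcal U)$ a measurable space. For $-\infty\le m\le n<\infty$ put $\mathcal Y_{m,n}=\bigvee_{k\in\mathbb Z,\,m\le k\le n}T^{-k}\mathcal Y$. For finite $m\le n$ let $\mathbb U_{m,n}$ be the set of $\mathcal Y_{m,n}$-measurable maps $u:\Omega\to U$, and let $\mathbb U_0=\bigcup_{-\infty<m\le 0}\mathbb U_{m,0}$. Let $\ell:U\times\Omega\to\mathbb R$ be (jointly) measurable with $|\ell(u,\omega)|\le\Lambda(\omega)$ for all $u,\omega$, where $\Lambda\in L^1(\mathbf P)$. For $u:\Omega\to U$ write $\ell_k(u)(\omega)=\ell(u(\omega),T^k\omega)$. A strategy $\mathbf u=(u_k)_{k\ge1}$ is admissible if $u_k\in\mathbb U_{0,k}$ for every $k\ge1$; its time-average loss is $L_N(\mathbf u)=\frac1N\sum_{k=1}^N\ell_k(u_k)$. An admissible strategy $\mathbf u^\star$ is pathwise optimal if $\liminf_{N\to\infty}\{L_N(\mathbf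 u)-L_N(\mathbf u^\star)\}\ge0$ a.s. for every admissible $\mathbf u$. Essential suprema and infima of families of random variables are taken with respect to almost sure order. Suppose that for some $\sigma$-field $\mathcal X\subset\mathcal B$: 1. $\mathcal X\subset T^{-1}\mathcal X$. 2. The following martingales converge uniformly as $n\to\infty$: $$\operatorname*{ess\,sup}_{u\in\mathbb U_0}\big|\mathbf E[\ell_0(u)|\mathcal Y_{-\infty,0}\vee T^{-n}\mathcal X]-\ell_0(u)\big|\to0\quad\text{in }L^1,$$ $$\operatorname*{ess\,sup}_{u\in\mathbb U_0}\Big|\mathbf E[\ell_0(u)|\mathcal Y_{-\infty,0}\vee T^{n}\mathcal X]-\mathbf E\Big[\ell_0(u)\Big|\bigcap_{k=1}^\infty(\mathcal Y_{-\infty,0}\vee T^{k}\mathcal X)\Big]\Big|\to0\quad\text{in }L^1,$$ $$\operatorname*{ess\,sup}_{u\in\mathbb U_{-n,0}}\big|\mathbf E[\ell_0(u)|\mathcal Y_{-n,0}]-\mathbf E[\ell_0(u)|\mathcal Y_{-\infty,0}]\big|\to0\quad\text{a.s.}$$ 3. For every $u\in\mathbb U_0$, almost surely $$\mathbf E[\ell_0(u)|\mathcal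 Y_{-\infty,0}]=\mathbf E\Big[\ell_0(u)\Big|\bigcap_{k=1}^\infty(\mathcal Y_{-\infty,0}\vee T^{k}\mathcal X)\Big].$$ Let $\mathbf{\tilde u}$ be a mean-optimal strategy in the following sense: $\mathbf{\tilde u}$ is admissible and, for every $k\ge1$, $$\mathbf E[\ell_k(\tilde u_k)|\mathcal Y_{0,k}]\le\operatorname*{ess\,inf}_{u\in\mathbb U_{0,k}}\mathbf E[\ell_k(u)|\mathcal Y_{0,k}]+k^{-1}\quad\text{a.s.}$$ Then $$L_N(\mathbf{\tilde u})\xrightarrow{N\to\infty}L^\star:=\mathbf E\Big[\operatorname*{ess\,inf}_{u\in\mathbb U_0}\mathbf E[\ell_0(u)|\mathcal Y_{-\infty,0}]\Big]\quad\text{a.s.},$$ and $\mathbf{\tilde u}$ is pathwise optimal. -/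

import Mathlib

open MeasureTheory Filter Topology

noncomputable section

namespace PathwiseDecision

/-! ### Essential suprema of arbitrary families of random variables -/

section EssentialSupremum

variable {Ω ι : Type*} {mΩ : MeasurableSpace Ω}

/-- `g` is a version of the essential supremum, over `i ∈ S`, of the random variables `f i`:
the least random variable, up to null sets, that dominates every `f i` almost surely.
(`S` may be uncountable, and this is not the pointwise supremum.) -/
structure IsFamilyEssSup (μ : Measure Ω) (S : Set ι) (f : ι → Ω → ℝ) (g : Ω → ℝ) : Prop where
  aemeasurable : AEMeasurable g μ
  le : ∀ i ∈ S, f i ≤ᵐ[μ] g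
  least : ∀ h : Ω → ℝ, AEMeasurable h μ → (∀ i ∈ S, f i ≤ᵐ[μ] h) → g ≤ᵐ[μ] h

open Classical in
/-- `ess sup_{i ∈ S} f i`. It is determined up to null sets, and it exists as soon as `S` is
nonempty and the `f i` are dominated above by one finite random variable (see
`isFamilyEssSup_familyEssSup`). -/
def familyEssSup (μ : Measure Ω) (S : Set ι) (f : ι → Ω → ℝ) : Ω → ℝ :=
  if h : ∃ g, IsFamilyEssSup μ S f g then h.choose else 0

/-- `ess inf_{i ∈ S} f i`. -/
def familyEssInf (μ : Measure Ω) (S : Set ι) (f : ι → Ω → ℝ) : Ω → ℝ :=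
  fun ω => -familyEssSup μ S (fun i ω => -f i ω) ω

/-- The essential supremum exists, and it is the supremum of a countable subfamily. -/
theorem exists_isFamilyEssSup (μ : Measure Ω) [IsFiniteMeasure μ] {S : Set ι} (hS : S.Nonempty)
    {f : ι → Ω → ℝ} (hf : ∀ i ∈ S, AEMeasurable (f i) μ)
    {H : Ω → ℝ} (hH : ∀ i ∈ S, f i ≤ᵐ[μ] H) :
    ∃ c : ℕ → ι, (∀ n, c n ∈ S) ∧ IsFamilyEssSup μ S f (fun ω => ⨆ n, f (c n) ω) := by
  classical
  obtain ⟨i₀, hi₀⟩ := hS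
  let V : (ℕ → ι) → Ω → ℝ := fun c ω => ⨆ n, Real.arctan (f (c n) ω)
  have hbdd : ∀ (c : ℕ → ι) (ω : Ω), BddAbove (Set.range fun n => Real.arctan (f (c n) ω)) := by
    intro c ω
    refine ⟨Real.pi / 2, ?_⟩
    rintro _ ⟨n, rfl⟩
    exact (Real.arctan_lt_pi_div_two _).le
  have hVle : ∀ c ω, V c ω ≤ Real.pi / 2 := fun c ω =>
    ciSup_le fun n => (Real.arctan_lt_pi_div_two _).le
  have hVge : ∀ c ω, -(Real.pi / 2) ≤ V c ω := fun c ω =>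
    (Real.neg_pi_div_two_lt_arctan _).le.trans (le_ciSup (hbdd c ω) 0)
  have hVm : ∀ c : ℕ → ι, (∀ n, c n ∈ S) → AEMeasurable (V c) μ := fun c hc =>
    AEMeasurable.iSup fun n => Real.measurable_arctan.comp_aemeasurable (hf _ (hc n))
  have hVi : ∀ c : ℕ → ι, (∀ n, c n ∈ S) → Integrable (V c) μ := fun c hc =>
    Integrable.of_bound (hVm c hc).aestronglyMeasurable (Real.pi / 2)
      (Eventually.of_forall fun ω => abs_le.2 ⟨hVge c ω, hVle c ω⟩)
  let A : Set ℝ := {x | ∃ c : ℕ → ι, (∀ n, c n ∈ S) ∧ x = ∫ ω, V c ω ∂μ}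
  have hA : A.Nonempty := ⟨_, fun _ => i₀, fun _ => hi₀, rfl⟩
  have hAb : BddAbove A := by
    refine ⟨∫ _, Real.pi / 2 ∂μ, ?_⟩
    rintro _ ⟨c, hc, rfl⟩
    exact integral_mono (hVi c hc) (integrable_const _) (hVle c)
  obtain ⟨x, -, hx, hxA⟩ := exists_seq_tendsto_sSup hA hAb
  choose d hd hxd using hxA
  let c : ℕ → ι := fun n => d n.unpair.1 n.unpair.2
  have hc : ∀ n, c n ∈ S := fun n => hd _ _
  have hdc : ∀ j ω, V (d j) ω ≤ V c ω := fun j ω => ciSup_le fun n => by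
    have := le_ciSup (hbdd c ω) (Nat.pair j n)
    simpa [c] using this
  have hmax : sSup A ≤ ∫ ω, V c ω ∂μ := le_of_tendsto' hx fun j => by
    rw [hxd]; exact integral_mono (hVi _ (hd j)) (hVi _ hc) (hdc j)
  have hdom : ∀ i ∈ S, ∀ᵐ ω ∂μ, Real.arctan (f i ω) ≤ V c ω := by
    intro i hi
    let c' : ℕ → ι := fun n => Nat.casesOn n i c
    have hc' : ∀ n, c' n ∈ S := fun n => by cases n with
      | zero => exact hi
      | succ n => exact hc n
    have hcc : ∀ ω, V c ω ≤ V c' ω := fun ω => ciSup_le fun n => le_ciSup (hbdd c' ω) (n + 1)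
    have hle : ∫ ω, V c' ω ∂μ ≤ ∫ ω, V c ω ∂μ := (le_csSup hAb ⟨c', hc', rfl⟩).trans hmax
    have h0 : ∫ ω, (V c' ω - V c ω) ∂μ = 0 := by
      refine le_antisymm ?_ (integral_nonneg fun ω => sub_nonneg.2 (hcc ω))
      rw [integral_sub (hVi _ hc') (hVi _ hc)]
      linarith
    rw [integral_eq_zero_iff_of_nonneg (fun ω => sub_nonneg.2 (hcc ω))
      ((hVi _ hc').sub (hVi _ hc))] at h0
    filter_upwards [h0] with ω hω
    have h1 : V c' ω = V c ω := by simpa [sub_eq_zero] using hω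
    rw [← h1]
    exact le_ciSup (hbdd c' ω) 0
  have hbd : ∀ᵐ ω ∂μ, BddAbove (Set.range fun n => f (c n) ω) := by
    have : ∀ᵐ ω ∂μ, ∀ n, f (c n) ω ≤ H ω := ae_all_iff.2 fun n => hH _ (hc n)
    filter_upwards [this] with ω hω
    exact ⟨H ω, by rintro _ ⟨n, rfl⟩; exact hω n⟩
  refine ⟨c, hc, AEMeasurable.iSup fun n => hf _ (hc n), ?_, ?_⟩
  · intro i hi
    filter_upwards [hdom i hi, hbd] with ω h1 h2
    refine Real.arctan_strictMono.le_iff_le.1 (h1.trans (ciSup_le fun n => ?_))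
    exact Real.arctan_strictMono.monotone (le_ciSup h2 n)
  · intro h _ hh
    have : ∀ᵐ ω ∂μ, ∀ n, f (c n) ω ≤ h ω := ae_all_iff.2 fun n => hh _ (hc n)
    filter_upwards [this] with ω hω
    exact ciSup_le hω

theorem isFamilyEssSup_familyEssSup (μ : Measure Ω) [IsFiniteMeasure μ] {S : Set ι}
    (hS : S.Nonempty) {f : ι → Ω → ℝ} (hf : ∀ i ∈ S, AEMeasurable (f i) μ)
    {H : Ω → ℝ} (hH : ∀ i ∈ S, f i ≤ᵐ[μ] H) :
    IsFamilyEssSup μ S f (familyEssSup μ S f) := by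
  have h : ∃ g, IsFamilyEssSup μ S f g :=
    let ⟨_, _, hc⟩ := exists_isFamilyEssSup μ hS hf hH
    ⟨_, hc⟩
  rw [familyEssSup, dif_pos h]
  exact h.choose_spec

end EssentialSupremum

/-! ### The decision problem -/

section Decision

variable {Ω U : Type*}

/-- The σ-field `T^{-k} 𝒢 = {T^{-k} A : A ∈ 𝒢}`, for `k ∈ ℤ` and `T` invertible. -/
def shiftField (T : Equiv.Perm Ω) (k : ℤ) (𝒢 : MeasurableSpace Ω) : MeasurableSpace Ω :=
  MeasurableSpace.comap (⇑(T ^ k)) 𝒢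

/-- The observations made at the times in `I`: `⋁_{k ∈ I} T^{-k} 𝒴`. Thus `𝒴_{m,n}` is
`obsField T 𝒴 (Set.Icc m n)` and `𝒴_{-∞,n}` is `obsField T 𝒴 (Set.Iic n)`. -/
def obsField (T : Equiv.Perm Ω) (𝒴 : MeasurableSpace Ω) (I : Set ℤ) : MeasurableSpace Ω :=
  ⨆ k ∈ I, shiftField T k 𝒴

/-- The `𝒴_{-∞,0} ∨ T^{n} 𝒳` for `n ∈ ℤ`. -/
def pastField (T : Equiv.Perm Ω) (𝒴 𝒳 : MeasurableSpace Ω) (n : ℤ) : MeasurableSpace Ω :=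
  obsField T 𝒴 (Set.Iic 0) ⊔ shiftField T (-n) 𝒳

/-- `⋂_{k ≥ 1} (𝒴_{-∞,0} ∨ T^{k} 𝒳)`. -/
def remotePastField (T : Equiv.Perm Ω) (𝒴 𝒳 : MeasurableSpace Ω) : MeasurableSpace Ω :=
  ⨅ (k : ℕ) (_ : 1 ≤ k), pastField T 𝒴 𝒳 k

/-- `𝕌_{m,n}`: the decisions that are `𝒴_{m,n}`-measurable. -/
def decisions (T : Equiv.Perm Ω) (𝒴 : MeasurableSpace Ω) (U : Type*) [MeasurableSpace U]
    (m n : ℤ) : Set (Ω → U) :=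
  {u | Measurable[obsField T 𝒴 (Set.Icc m n)] u}

/-- `𝕌_n = ⋃_{-∞ < m ≤ n} 𝕌_{m,n}`: the decisions that depend on finitely many observations
up to time `n`. -/
def finiteDecisions (T : Equiv.Perm Ω) (𝒴 : MeasurableSpace Ω) (U : Type*) [MeasurableSpace U]
    (n : ℤ) : Set (Ω → U) :=
  {u | ∃ m : ℤ, m ≤ n ∧ u ∈ decisions T 𝒴 U m n}

/-- A strategy `(u_k)_{k ≥ 1}` is admissible if every `u_k` is `𝒴_{0,k}`-measurable.
(The entry `u 0` plays no role.) -/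
def IsAdmissible (T : Equiv.Perm Ω) (𝒴 : MeasurableSpace Ω) [MeasurableSpace U]
    (u : ℕ → Ω → U) : Prop :=
  ∀ k : ℕ, 1 ≤ k → u k ∈ decisions T 𝒴 U 0 k

/-- `ℓ_k(u)(ω) = ℓ(u(ω), T^k ω)`. -/
def lossAt (T : Equiv.Perm Ω) (ℓ : U → Ω → ℝ) (k : ℤ) (u : Ω → U) (ω : Ω) : ℝ :=
  ℓ (u ω) ((T ^ k) ω)

/-- The time-average loss `L_N(𝐮) = (1/N) ∑_{k=1}^N ℓ_k(u_k)`. -/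
def avgLoss (T : Equiv.Perm Ω) (ℓ : U → Ω → ℝ) (u : ℕ → Ω → U) (N : ℕ) (ω : Ω) : ℝ :=
  (1 / (N : ℝ)) * ∑ k ∈ Finset.Icc 1 N, lossAt T ℓ k (u k) ω

/-- Pathwise optimality of an admissible strategy (the lower limit is taken in `[-∞, ∞]`). -/
def IsPathwiseOptimal (T : Equiv.Perm Ω) (𝒴 : MeasurableSpace Ω) {mΩ : MeasurableSpace Ω}
    (μ : Measure Ω) [MeasurableSpace U] (ℓ : U → Ω → ℝ) (v : ℕ → Ω → U) : Prop :=
  IsAdmissible T 𝒴 v ∧ ∀ u : ℕ → Ω → U, IsAdmissible T 𝒴 u →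
    ∀ᵐ ω ∂μ, (0 : EReal) ≤
      liminf (fun N : ℕ => ((avgLoss T ℓ u N ω - avgLoss T ℓ v N ω : ℝ) : EReal)) atTop

/-- The mean-optimal strategy: `v` is admissible and, for every `k ≥ 1`, almost surely
`E[ℓ_k(v_k) | 𝒴_{0,k}] ≤ ess inf_{u ∈ 𝕌_{0,k}} E[ℓ_k(u) | 𝒴_{0,k}] + 1/k`. -/
def IsMeanOptimalSelection (T : Equiv.Perm Ω) (𝒴 : MeasurableSpace Ω) {mΩ : MeasurableSpace Ω}
    (μ : Measure Ω) [MeasurableSpace U] (ℓ : U → Ω → ℝ) (v : ℕ → Ω → U) : Prop :=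
  IsAdmissible T 𝒴 v ∧ ∀ k : ℕ, 1 ≤ k →
    ∀ᵐ ω ∂μ, (μ[lossAt T ℓ k (v k) | obsField T 𝒴 (Set.Icc 0 (k : ℤ))]) ω ≤
      familyEssInf μ (decisions T 𝒴 U 0 k)
        (fun u => μ[lossAt T ℓ k u | obsField T 𝒴 (Set.Icc 0 (k : ℤ))]) ω + 1 / (k : ℝ)

/-- `L^* = E[ess inf_{u ∈ 𝕌_0} E[ℓ_0(u) | 𝒴_{-∞,0}]]`. -/
def optimalLoss (T : Equiv.Perm Ω) (𝒴 : MeasurableSpace Ω) {mΩ : MeasurableSpace Ω}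
    (μ : Measure Ω) [MeasurableSpace U] (ℓ : U → Ω → ℝ) : ℝ :=
  ∫ ω, familyEssInf μ (finiteDecisions T 𝒴 U 0)
    (fun u => μ[lossAt T ℓ 0 u | obsField T 𝒴 (Set.Iic 0)]) ω ∂μ

end Decision

end PathwiseDecision

end

/-! The decision taken at time `k` is viewed from time `k`: put `w_k = u_k ∘ T^{-k}`, which lies in
`𝕌_{-k,0}`. Then `ℓ_k(u_k) = ℓ_0(w_k) ∘ T^k`. With `a(w) = E[ℓ_0(w) | 𝒴_{-∞,0}]`, the loss `L_N(𝐮)`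
is the average of `(ℓ_0(w_k) - a(w_k)) ∘ T^k` plus the average of `a(w_k) ∘ T^k`.

The first average vanishes for every admissible strategy (`ae_tendsto_cesaro_lossAt_sub_condExp`).
Let `𝒢_n = 𝒴_{-∞,0} ∨ T^n 𝒳`, a decreasing family. Uniformly over decisions, `ℓ_0(w)` is close in
`L¹` to `E[ℓ_0(w) | 𝒢_{-n}]`, and `a(w)`, which by assumption is the conditional expectation given
the remote past, is close to `E[ℓ_0(w) | 𝒢_n]`. The gap between the two approximants is a sum of
`2n` increments. Since `𝒢_n ⊆ T^{-1} 𝒢_{n+1}`, each increment moved along the orbit is a martingale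
difference sequence, so its averages vanish (`ae_tendsto_cesaro_condExp_sub`). The approximation
errors are bounded by one function per `n`, independent of `k`, so the ergodic theorem bounds their
averages by a small mean.

For the second average, let `F` be the essential infimum of `a` over `𝕌_0`. Always `a(w_k) ≥ F`, and
the averages of `F ∘ T^k` tend to `E[F] = L^*`, so no admissible strategy does better
asymptotically. For the mean-optimal strategy the third martingale condition gives `a(w_k) → F`
almost surely (`IsMeanOptimalSelection.ae_tendsto_condExp`), and Maker's theorem
(`ae_tendsto_cesaro_of_dominated`) carries this convergence to the averages along the orbit. -/

noncomputable section

namespace PathwiseDecision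

/-! ### Cesàro averages -/

/-- The average of the terms `x 1, …, x N`. -/
def cesaro (x : ℕ → ℝ) (N : ℕ) : ℝ := (1 / (N : ℝ)) * ∑ k ∈ Finset.Icc 1 N, x k

theorem cesaro_eq_sum_range (x : ℕ → ℝ) (N : ℕ) :
    cesaro x N = (1 / (N : ℝ)) * ∑ k ∈ Finset.range N, x (k + 1) := by
  have h : ∑ k ∈ Finset.Icc 1 N, x k = ∑ k ∈ Finset.range N, x (k + 1) := by
    induction N with
    | zero => simp
    | succ n ih => rw [Finset.sum_Icc_succ_top (by omega), Finset.sum_range_succ, ih]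
  rw [cesaro, h]

theorem cesaro_sub (x y : ℕ → ℝ) (N : ℕ) :
    cesaro (fun k => x k - y k) N = cesaro x N - cesaro y N := by
  simp only [cesaro, Finset.sum_sub_distrib, mul_sub]

theorem cesaro_add (x y : ℕ → ℝ) (N : ℕ) :
    cesaro (fun k => x k + y k) N = cesaro x N + cesaro y N := by
  simp only [cesaro, Finset.sum_add_distrib, mul_add]

theorem cesaro_mono {x y : ℕ → ℝ} (h : ∀ k, 1 ≤ k → x k ≤ y k) (N : ℕ) :
    cesaro x N ≤ cesaro y N :=
  mul_le_mul_of_nonneg_left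
    (Finset.sum_le_sum fun k hk => h k (Finset.mem_Icc.1 hk).1) (by positivity)

theorem cesaro_congr {x y : ℕ → ℝ} (h : ∀ k, 1 ≤ k → x k = y k) (N : ℕ) :
    cesaro x N = cesaro y N :=
  le_antisymm (cesaro_mono (fun k hk => (h k hk).le) N) (cesaro_mono (fun k hk => (h k hk).ge) N)

theorem abs_cesaro_le (x : ℕ → ℝ) (N : ℕ) : |cesaro x N| ≤ cesaro (fun k => |x k|) N := by
  unfold cesaro
  rw [abs_mul, abs_of_nonneg (by positivity : (0 : ℝ) ≤ 1 / (N : ℝ))]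
  exact mul_le_mul_of_nonneg_left (Finset.abs_sum_le_sum_abs _ _) (by positivity)

theorem tendsto_cesaro_of_tendsto {x : ℕ → ℝ} {a : ℝ} (h : Tendsto x atTop (𝓝 a)) :
    Tendsto (cesaro x) atTop (𝓝 a) := by
  have h1 := (h.comp (tendsto_add_atTop_nat 1)).cesaro
  refine h1.congr fun N => ?_
  simp only [cesaro_eq_sum_range, one_div, Function.comp]

/-- A bounded sequence whose averages vanish along the squares has vanishing averages. -/
theorem tendsto_cesaro_of_tendsto_sq {x : ℕ → ℝ} {C : ℝ} (hx : ∀ k, 1 ≤ k → |x k| ≤ C)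
    (h : Tendsto (fun n : ℕ => cesaro x (n ^ 2)) atTop (𝓝 0)) :
    Tendsto (cesaro x) atTop (𝓝 0) := by
  have hC : 0 ≤ C := (abs_nonneg _).trans (hx 1 le_rfl)
  have hsqrt : Tendsto Nat.sqrt atTop atTop :=
    tendsto_atTop_atTop.2 fun b => ⟨b ^ 2, fun a ha => Nat.le_sqrt'.2 ha⟩
  -- With `n = ⌊√N⌋` at most `2n` indices lie in `(n², N]`. Their terms are bounded by `C`, and
  -- dividing by `N ≥ n²` leaves an error of at most `2C/n`.
  have hlim : Tendsto (fun n : ℕ => |cesaro x (n ^ 2)| + 2 * C * (1 / (n : ℝ))) atTop (𝓝 0) := by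
    simpa using h.abs.add (tendsto_one_div_atTop_nhds_zero_nat.const_mul (2 * C))
  refine squeeze_zero_norm' ?_ (hlim.comp hsqrt)
  filter_upwards [eventually_ge_atTop 1] with N hN
  set n := Nat.sqrt N with hn
  have hn1 : 1 ≤ n := Nat.le_sqrt'.2 (by simpa using hN)
  have h1 : n ^ 2 ≤ N := Nat.sqrt_le' N
  have h2 : N ≤ n ^ 2 + 2 * n := by
    have := Nat.sqrt_le_add N
    rw [← hn] at this
    nlinarith
  have hsplit : ∑ k ∈ Finset.Icc 1 N, x k
      = ∑ k ∈ Finset.Icc 1 (n ^ 2), x k + ∑ k ∈ Finset.Ioc (n ^ 2) N, x k := by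
    rw [← Finset.sum_union]
    · congr 1
      ext k
      simp only [Finset.mem_union, Finset.mem_Icc, Finset.mem_Ioc]
      omega
    · rw [Finset.disjoint_left]
      intro k
      simp only [Finset.mem_Icc, Finset.mem_Ioc]
      omega
  have htail : |∑ k ∈ Finset.Ioc (n ^ 2) N, x k| ≤ 2 * n * C := by
    refine (Finset.abs_sum_le_sum_abs _ _).trans ?_
    refine (Finset.sum_le_card_nsmul _ _ C fun k hk => hx k ?_).trans ?_
    · have := (Finset.mem_Ioc.1 hk).1
      omega
    · rw [Nat.card_Ioc, nsmul_eq_mul]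
      have : ((N - n ^ 2 : ℕ) : ℝ) ≤ 2 * n := by
        have : N - n ^ 2 ≤ 2 * n := by omega
        exact_mod_cast this
      gcongr
  have hnR : (0 : ℝ) < n := by exact_mod_cast hn1
  have hNR : ((n : ℝ) ^ 2) ≤ N := by exact_mod_cast h1
  have hle : 1 / (N : ℝ) ≤ 1 / (n : ℝ) ^ 2 := one_div_le_one_div_of_le (by positivity) hNR
  simp only [Real.norm_eq_abs, cesaro, Function.comp, ← hn]
  rw [hsplit, abs_mul, abs_mul, abs_of_nonneg (by positivity : (0 : ℝ) ≤ 1 / (N : ℝ)),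
    abs_of_nonneg (by positivity : (0 : ℝ) ≤ 1 / ((n ^ 2 : ℕ) : ℝ))]
  push_cast
  calc 1 / (N : ℝ) * |∑ k ∈ Finset.Icc 1 (n ^ 2), x k + ∑ k ∈ Finset.Ioc (n ^ 2) N, x k|
      ≤ 1 / (n : ℝ) ^ 2 * (|∑ k ∈ Finset.Icc 1 (n ^ 2), x k| + 2 * n * C) := by
        gcongr
        exact (abs_add_le _ _).trans (by gcongr)
    _ = 1 / (n : ℝ) ^ 2 * |∑ k ∈ Finset.Icc 1 (n ^ 2), x k| + 2 * C * (1 / (n : ℝ)) := by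
        field_simp

/-! ### The pointwise ergodic theorem -/

section Birkhoff

variable {Ω : Type*} {mΩ : MeasurableSpace Ω} {μ : Measure Ω}

theorem integral_comp_of_measurePreserving {T : Ω → Ω} (hT : MeasurePreserving T μ μ)
    {f : Ω → ℝ} (hf : AEStronglyMeasurable f μ) : ∫ ω, f (T ω) ∂μ = ∫ ω, f ω ∂μ := by
  have h := integral_map (μ := μ) hT.measurable.aemeasurable (f := f) (by rwa [hT.map_eq])
  rw [← h, hT.map_eq]

/-- The largest of the first `n + 1` nonempty Birkhoff sums of `f`. -/
def maxBirkhoffSum (T : Ω → Ω) (f : Ω → ℝ) : ℕ → Ω → ℝ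
  | 0 => f
  | n + 1 => fun ω => f ω + max 0 (maxBirkhoffSum T f n (T ω))

theorem maxBirkhoffSum_le_succ (T : Ω → Ω) (f : Ω → ℝ) (n : ℕ) (ω : Ω) :
    maxBirkhoffSum T f n ω ≤ maxBirkhoffSum T f (n + 1) ω := by
  induction n generalizing ω with
  | zero => simp [maxBirkhoffSum]
  | succ n ih =>
    rw [maxBirkhoffSum, maxBirkhoffSum]
    exact add_le_add le_rfl (max_le_max le_rfl (ih (T ω)))

theorem maxBirkhoffSum_monotone (T : Ω → Ω) (f : Ω → ℝ) (ω : Ω) :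
    Monotone fun n => maxBirkhoffSum T f n ω :=
  monotone_nat_of_le_succ fun n => maxBirkhoffSum_le_succ T f n ω

theorem birkhoffSum_le_maxBirkhoffSum (T : Ω → Ω) (f : Ω → ℝ) (n : ℕ) (ω : Ω) :
    birkhoffSum T f (n + 1) ω ≤ maxBirkhoffSum T f n ω := by
  induction n generalizing ω with
  | zero => simp [maxBirkhoffSum]
  | succ n ih =>
    rw [birkhoffSum_succ', maxBirkhoffSum]
    exact add_le_add le_rfl ((ih _).trans (le_max_right _ _))

theorem measurable_maxBirkhoffSum {T : Ω → Ω} {f : Ω → ℝ} (hT : Measurable T) (hf : Measurable f)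
    (n : ℕ) : Measurable (maxBirkhoffSum T f n) := by
  induction n with
  | zero => exact hf
  | succ n ih => exact hf.add (measurable_const.max (ih.comp hT))

theorem integrable_maxBirkhoffSum {T : Ω → Ω} {f : Ω → ℝ} (hT : MeasurePreserving T μ μ)
    (hf : Integrable f μ) (n : ℕ) : Integrable (maxBirkhoffSum T f n) μ := by
  induction n with
  | zero => exact hf
  | succ n ih =>
    have h := (hT.integrable_comp_of_integrable ih).pos_part
    refine hf.add (h.congr (Eventually.of_forall fun ω => ?_))
    simp [max_comm]

/-- Birkhoff sums of a function with negative mean are bounded above along almost every orbit. -/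
theorem ae_bddAbove_maxBirkhoffSum {T : Ω → Ω} {f : Ω → ℝ} (hT : Ergodic T μ)
    (hfm : Measurable f) (hf : Integrable f μ) (hneg : ∫ ω, f ω ∂μ < 0) :
    ∀ᵐ ω ∂μ, BddAbove (Set.range fun n => maxBirkhoffSum T f n ω) := by
  have hTm := hT.measurable
  -- Moving the starting point by one step does not affect boundedness, so `A` is invariant and by
  -- ergodicity null or of full measure.
  let A : Set Ω := {ω | BddAbove (Set.range fun n => maxBirkhoffSum T f n ω)}
  have hA : MeasurableSet A :=
    measurableSet_bddAbove_range fun n => measurable_maxBirkhoffSum hTm hfm n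
  have hTA : T ⁻¹' A = A := by
    ext ω
    constructor
    · rintro ⟨C, hC⟩
      refine ⟨f ω + max 0 C, ?_⟩
      rintro _ ⟨n, rfl⟩
      refine (maxBirkhoffSum_le_succ T f n ω).trans ?_
      rw [maxBirkhoffSum]
      exact add_le_add le_rfl (max_le_max le_rfl (hC ⟨n, rfl⟩))
    · rintro ⟨C, hC⟩
      refine ⟨C - f ω, ?_⟩
      rintro _ ⟨n, rfl⟩
      have h := hC ⟨n + 1, rfl⟩
      simp only [maxBirkhoffSum] at h
      have := le_max_right 0 (maxBirkhoffSum T f n (T ω))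
      simp only
      linarith
  rcases hT.toPreErgodic.ae_mem_or_ae_notMem hA hTA with h | h
  · exact h
  exfalso
  have hMi := integrable_maxBirkhoffSum hT.toMeasurePreserving hf
  have hcomp : ∀ n, ∫ ω, maxBirkhoffSum T f n (T ω) ∂μ = ∫ ω, maxBirkhoffSum T f n ω ∂μ :=
    fun n => integral_comp_of_measurePreserving hT.toMeasurePreserving (hMi n).aestronglyMeasurable
  -- By the recursion `d n = f + (M_n ∘ T)⁻`, where `M_n` is the maximal sum. Its integral equals `∫
  -- (M_{n+1} - M_n) ≥ 0` by invariance. If the sums were unbounded almost everywhere, `d n → f`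
  -- dominatedly, forcing `∫ f ≥ 0`.
  let d : ℕ → Ω → ℝ := fun n ω => maxBirkhoffSum T f (n + 1) ω - maxBirkhoffSum T f n (T ω)
  have hd : ∀ n, 0 ≤ ∫ ω, d n ω ∂μ := by
    intro n
    have h1 : ∫ ω, d n ω ∂μ
        = ∫ ω, maxBirkhoffSum T f (n + 1) ω ∂μ - ∫ ω, maxBirkhoffSum T f n (T ω) ∂μ :=
      integral_sub (hMi _) (hT.toMeasurePreserving.integrable_comp_of_integrable (hMi n))
    rw [h1, hcomp, sub_nonneg]
    exact integral_mono (hMi _) (hMi _) (maxBirkhoffSum_le_succ T f n)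
  have hfT : Integrable (fun ω => f (T ω)) μ :=
    hT.toMeasurePreserving.integrable_comp_of_integrable hf
  have hlim : Tendsto (fun n => ∫ ω, d n ω ∂μ) atTop (𝓝 (∫ ω, f ω ∂μ)) := by
    refine tendsto_integral_of_dominated_convergence (fun ω => |f ω| + |f (T ω)|)
      (fun n => ((hMi _).sub
        (hT.toMeasurePreserving.integrable_comp_of_integrable (hMi n))).aestronglyMeasurable)
      (hf.abs.add hfT.abs) (fun n => Eventually.of_forall fun ω => ?_) ?_
    · have h0 : f (T ω) ≤ maxBirkhoffSum T f n (T ω) :=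
        maxBirkhoffSum_monotone T f (T ω) (Nat.zero_le n)
      simp only [d, maxBirkhoffSum, Real.norm_eq_abs]
      rcases max_cases 0 (maxBirkhoffSum T f n (T ω)) with ⟨h1, h2⟩ | ⟨h1, h2⟩ <;>
        rw [h1, abs_le] <;>
        constructor <;>
        linarith [neg_abs_le (f ω), le_abs_self (f ω), neg_abs_le (f (T ω)), abs_nonneg (f (T ω))]
    · filter_upwards [h] with ω hω
      have hTω : T ω ∉ A := fun hh => hω (by rw [← hTA]; exact hh)
      have htop := (maxBirkhoffSum_monotone T f (T ω)).tendsto_atTop_atTop fun b => by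
        by_contra! hb
        exact hTω ⟨b, by rintro _ ⟨n, rfl⟩; exact (hb n).le⟩
      refine tendsto_const_nhds.congr' ?_
      filter_upwards [htop.eventually_ge_atTop 0] with n hn
      simp only [d, maxBirkhoffSum]
      rw [max_eq_right hn]
      ring
  have := ge_of_tendsto' hlim hd
  linarith

/-- For `b` strictly between the mean and `c`, the function `f - b` has negative mean, so its sums
stay below a finite `C(ω)`, which `(c - b) N` eventually absorbs. -/
theorem ae_eventually_birkhoffSum_le [IsProbabilityMeasure μ] {T : Ω → Ω} {f : Ω → ℝ}
    (hT : Ergodic T μ) (hfm : Measurable f) (hf : Integrable f μ) {c : ℝ}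
    (hc : ∫ ω, f ω ∂μ < c) :
    ∀ᵐ ω ∂μ, ∀ᶠ N : ℕ in atTop, birkhoffSum T f N ω ≤ c * N := by
  obtain ⟨b, hb1, hb2⟩ := exists_between hc
  have hneg : ∫ ω, (f ω - b) ∂μ < 0 := by
    rw [integral_sub hf (integrable_const _)]
    simp [hb1]
  filter_upwards [ae_bddAbove_maxBirkhoffSum hT (hfm.sub_const b) (hf.sub (integrable_const b)) hneg]
    with ω ⟨C, hC⟩
  have hlin : Tendsto (fun N : ℕ => (c - b) * (N : ℝ)) atTop atTop :=
    tendsto_natCast_atTop_atTop.const_mul_atTop (sub_pos.2 hb2)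
  filter_upwards [hlin.eventually_ge_atTop C, eventually_ge_atTop 1] with N hN hN1
  obtain ⟨n, rfl⟩ := Nat.exists_eq_add_of_le' hN1
  have h1 := (birkhoffSum_le_maxBirkhoffSum T (fun ω => f ω - b) n ω).trans (hC ⟨n, rfl⟩)
  have h2 : birkhoffSum T (fun ω => f ω - b) (n + 1) ω
      = birkhoffSum T f (n + 1) ω - b * ((n + 1 : ℕ) : ℝ) := by
    simp only [birkhoffSum, Finset.sum_sub_distrib, Finset.sum_const, Finset.card_range,
      nsmul_eq_mul]
    ring
  rw [h2] at h1
  linarith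

/-- The pointwise ergodic theorem. -/
theorem ae_tendsto_cesaro_ergodic [IsProbabilityMeasure μ] {T : Ω → Ω} {f : Ω → ℝ}
    (hT : Ergodic T μ) (hf : Integrable f μ) :
    ∀ᵐ ω ∂μ, Tendsto (cesaro fun k => f (T^[k] ω)) atTop (𝓝 (∫ ω, f ω ∂μ)) := by
  -- A measurable version of `f`, composed with `T` because the averages start at index `1` and
  -- Birkhoff sums at index `0`.
  let g : Ω → ℝ := fun ω => hf.1.mk f (T ω)
  have hTp := hT.toMeasurePreserving
  have hmk : Integrable (hf.1.mk f) μ := hf.congr hf.1.ae_eq_mk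
  have hgm : Measurable g := hf.1.stronglyMeasurable_mk.measurable.comp hT.measurable
  have hg : Integrable g μ := hTp.integrable_comp_of_integrable hmk
  have hint : ∫ ω, g ω ∂μ = ∫ ω, f ω ∂μ := by
    rw [integral_congr_ae hf.1.ae_eq_mk]
    exact integral_comp_of_measurePreserving hTp hmk.aestronglyMeasurable
  have hfg : ∀ᵐ ω ∂μ, ∀ k, f (T^[k] ω) = hf.1.mk f (T^[k] ω) :=
    ae_all_iff.2 fun k => (hTp.iterate k).quasiMeasurePreserving.ae hf.1.ae_eq_mk
  have hup : ∀ᵐ ω ∂μ, ∀ j : ℕ, ∀ᶠ N : ℕ in atTop,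
      birkhoffSum T g N ω ≤ (∫ ω, f ω ∂μ + 1 / ((j : ℝ) + 1)) * N :=
    ae_all_iff.2 fun j => ae_eventually_birkhoffSum_le hT hgm hg (by
      rw [hint]
      have : (0 : ℝ) < 1 / ((j : ℝ) + 1) := by positivity
      linarith)
  have hlo : ∀ᵐ ω ∂μ, ∀ j : ℕ, ∀ᶠ N : ℕ in atTop,
      birkhoffSum T (fun ω => -g ω) N ω ≤ (-∫ ω, f ω ∂μ + 1 / ((j : ℝ) + 1)) * N :=
    ae_all_iff.2 fun j => ae_eventually_birkhoffSum_le hT hgm.neg hg.neg (by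
      rw [show ∫ ω, (-g) ω ∂μ = -∫ ω, g ω ∂μ from integral_neg g, hint]
      have : (0 : ℝ) < 1 / ((j : ℝ) + 1) := by positivity
      linarith)
  filter_upwards [hfg, hup, hlo] with ω h1 h2 h3
  have hces : ∀ N, cesaro (fun k => f (T^[k] ω)) N = 1 / (N : ℝ) * birkhoffSum T g N ω := by
    intro N
    simp only [cesaro_eq_sum_range, birkhoffSum, g]
    refine congrArg _ (Finset.sum_congr rfl fun k _ => ?_)
    rw [h1, Function.iterate_succ_apply']
  rw [Metric.tendsto_atTop']
  intro ε hε
  obtain ⟨j, hj⟩ := exists_nat_one_div_lt hε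
  obtain ⟨N₀, hN₀⟩ := eventually_atTop.1 ((h2 j).and (h3 j))
  refine ⟨N₀, fun N hN => ?_⟩
  have hNpos : (0 : ℝ) < N := by exact_mod_cast (Nat.zero_le N₀).trans_lt hN
  obtain ⟨h4, h5⟩ := hN₀ N hN.le
  have h6 : birkhoffSum T (fun ω => -g ω) N ω = -birkhoffSum T g N ω := by
    simp [birkhoffSum]
  rw [h6] at h5
  rw [hces, Real.dist_eq, abs_lt, one_div_mul_eq_div]
  constructor
  · rw [lt_sub_iff_add_lt, lt_div_iff₀ hNpos]
    nlinarith
  · rw [sub_lt_iff_lt_add, div_lt_iff₀ hNpos]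
    nlinarith

/-- Cesàro convergence to zero may be checked up to stationary errors of small mean. -/
theorem ae_tendsto_cesaro_of_approx [IsProbabilityMeasure μ] {T : Ω → Ω} (hT : Ergodic T μ)
    {x : ℕ → Ω → ℝ} {y : ℕ → ℕ → Ω → ℝ} {h : ℕ → Ω → ℝ} (hh : ∀ n, Integrable (h n) μ)
    (hlim : Tendsto (fun n => ∫ ω, h n ω ∂μ) atTop (𝓝 0))
    (hxy : ∀ n k, 1 ≤ k → ∀ᵐ ω ∂μ, |x k ω - y n k ω| ≤ h n (T^[k] ω))
    (hy : ∀ n, ∀ᵐ ω ∂μ, Tendsto (cesaro fun k => y n k ω) atTop (𝓝 0)) :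
    ∀ᵐ ω ∂μ, Tendsto (cesaro fun k => x k ω) atTop (𝓝 0) := by
  have hxy' : ∀ᵐ ω ∂μ, ∀ n k, 1 ≤ k → |x k ω - y n k ω| ≤ h n (T^[k] ω) := by
    refine ae_all_iff.2 fun n => ae_all_iff.2 fun k => ?_
    by_cases hk : 1 ≤ k
    · filter_upwards [hxy n k hk] with ω hω _ using hω
    · exact Eventually.of_forall fun ω h => absurd h hk
  filter_upwards [hxy', ae_all_iff.2 hy, ae_all_iff.2 fun n => ae_tendsto_cesaro_ergodic hT (hh n)]
    with ω h1 h2 h3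
  rw [Metric.tendsto_nhds]
  intro ε hε
  obtain ⟨n, hn⟩ := (hlim.eventually_lt_const (half_pos hε)).exists
  filter_upwards [(h3 n).eventually_lt_const hn,
    (Metric.tendsto_nhds.1 (h2 n)) (ε / 2) (half_pos hε)] with N h4 h5
  rw [Real.dist_eq, sub_zero] at h5 ⊢
  have h6 : |cesaro (fun k => x k ω) N - cesaro (fun k => y n k ω) N|
      ≤ cesaro (fun k => h n (T^[k] ω)) N := by
    rw [← cesaro_sub]
    exact (abs_cesaro_le _ _).trans (cesaro_mono (fun k hk => h1 n k hk) N)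
  calc |cesaro (fun k => x k ω) N|
      = |(cesaro (fun k => x k ω) N - cesaro (fun k => y n k ω) N)
          + cesaro (fun k => y n k ω) N| := by
        ring_nf
    _ ≤ _ := abs_add_le _ _
    _ < ε := by linarith

/-- Maker's ergodic theorem, for a sequence converging to zero. -/
theorem ae_tendsto_cesaro_of_dominated [IsProbabilityMeasure μ] {T : Ω → Ω} (hT : Ergodic T μ)
    {e : ℕ → Ω → ℝ} {G : Ω → ℝ} (he : ∀ k, AEMeasurable (e k) μ) (hG : Integrable G μ)
    (heG : ∀ k, 1 ≤ k → ∀ᵐ ω ∂μ, |e k ω| ≤ G ω)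
    (hlim : ∀ᵐ ω ∂μ, Tendsto (fun k => e k ω) atTop (𝓝 0)) :
    ∀ᵐ ω ∂μ, Tendsto (cesaro fun k => e k (T^[k] ω)) atTop (𝓝 0) := by
  -- The supremum over indices beyond `n` is a single function of `ω`, so along the orbit it is a
  -- stationary error; its mean vanishes by dominated convergence.
  let s : ℕ → Ω → ℝ := fun n ω => ⨆ j : ℕ, |e (n + 1 + j) ω|
  have hall : ∀ᵐ ω ∂μ, ∀ k, 1 ≤ k → |e k ω| ≤ G ω := by
    refine ae_all_iff.2 fun k => ?_
    by_cases hk : 1 ≤ k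
    · filter_upwards [heG k hk] with ω hω _ using hω
    · exact Eventually.of_forall fun ω h => absurd h hk
  have hbdd : ∀ᵐ ω ∂μ, ∀ n, BddAbove (Set.range fun j : ℕ => |e (n + 1 + j) ω|) := by
    filter_upwards [hall] with ω hω n
    exact ⟨G ω, by rintro _ ⟨j, rfl⟩; exact hω _ (by omega)⟩
  have hsm : ∀ n, AEMeasurable (s n) μ := fun n => AEMeasurable.iSup fun j => (he _).abs
  have hsG : ∀ n, ∀ᵐ ω ∂μ, ‖s n ω‖ ≤ G ω := by
    intro n
    filter_upwards [hall] with ω hω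
    rw [Real.norm_of_nonneg (Real.iSup_nonneg fun j => abs_nonneg _)]
    exact ciSup_le fun j => hω _ (by omega)
  have hs0 : ∀ᵐ ω ∂μ, Tendsto (fun n => s n ω) atTop (𝓝 0) := by
    filter_upwards [hlim] with ω hω
    rw [Metric.tendsto_atTop] at hω ⊢
    intro ε hε
    obtain ⟨N, hN⟩ := hω (ε / 2) (half_pos hε)
    refine ⟨N, fun n hn => ?_⟩
    rw [Real.dist_eq, sub_zero, abs_of_nonneg (Real.iSup_nonneg fun j => abs_nonneg _)]
    refine lt_of_le_of_lt (ciSup_le fun j => ?_) (half_lt_self hε)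
    have := hN (n + 1 + j) (by omega)
    rw [Real.dist_eq, sub_zero] at this
    exact this.le
  -- The approximant keeps only the first `n` terms, which cannot affect the limit of the averages.
  refine ae_tendsto_cesaro_of_approx hT (x := fun k ω => e k (T^[k] ω))
    (y := fun n k ω => if k ≤ n then e k (T^[k] ω) else 0) (h := s)
    (fun n => hG.mono' (hsm n).aestronglyMeasurable (hsG n)) ?_ ?_ ?_
  · simpa using tendsto_integral_of_dominated_convergence G
      (fun n => (hsm n).aestronglyMeasurable) hG hsG hs0
  · intro n k _
    filter_upwards [(hT.toMeasurePreserving.iterate k).quasiMeasurePreserving.ae hbdd] with ω hω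
    by_cases hk : k ≤ n
    · simp only [hk, if_true, sub_self, abs_zero]
      exact Real.iSup_nonneg fun j => abs_nonneg _
    · simp only [hk, if_false, sub_zero]
      obtain ⟨j, rfl⟩ := Nat.exists_eq_add_of_lt (not_le.1 hk)
      have := le_ciSup (hω n) j
      rw [add_right_comm] at this
      exact this
  · intro n
    refine Eventually.of_forall fun ω => tendsto_cesaro_of_tendsto ?_
    refine tendsto_const_nhds.congr' ?_
    filter_upwards [eventually_gt_atTop n] with k hk
    simp [not_le.2 hk]

end Birkhoff

/-! ### A strong law for bounded orthogonal sequences -/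

/-- Orthogonality bounds the second moment of the `N`-th sum by `N C²`. Along the squares the
averages then have second moment at most `C²/n²`, which is summable, so they vanish almost surely;
boundedness fills the gaps between squares. -/
theorem ae_tendsto_cesaro_of_orthogonal {Ω : Type*} {mΩ : MeasurableSpace Ω} {μ : Measure Ω}
    [IsProbabilityMeasure μ] {x : ℕ → Ω → ℝ} {C : ℝ} (hx : ∀ k, AEStronglyMeasurable (x k) μ)
    (hC : ∀ k, ∀ᵐ ω ∂μ, |x k ω| ≤ C)
    (horth : ∀ k l, k < l → ∫ ω, x k ω * x l ω ∂μ = 0) :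
    ∀ᵐ ω ∂μ, Tendsto (cesaro fun k => x k ω) atTop (𝓝 0) := by
  let S : ℕ → Ω → ℝ := fun N ω => ∑ k ∈ Finset.Icc 1 N, x k ω
  have hxb : ∀ k, MemLp (x k) ⊤ μ := fun k => memLp_top_of_bound (hx k) C (hC k)
  have hS2 : ∀ N, MemLp (S N) 2 μ := fun N =>
    memLp_finsetSum _ fun k _ => (hxb k).mono_exponent le_top
  have hx2 : ∀ k, MemLp (x k) 2 μ := fun k => (hxb k).mono_exponent le_top
  have hvar : ∀ N : ℕ, ∫ ω, S N ω ^ 2 ∂μ ≤ N * C ^ 2 := by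
    intro N
    induction N with
    | zero => simp [S]
    | succ N ih =>
      have hS : ∀ ω, S (N + 1) ω ^ 2
          = S N ω ^ 2 + 2 * (S N ω * x (N + 1) ω) + x (N + 1) ω ^ 2 := by
        intro ω
        simp only [S]
        rw [Finset.sum_Icc_succ_top (by omega)]
        ring
      have hcross : ∫ ω, S N ω * x (N + 1) ω ∂μ = 0 := by
        simp only [S, Finset.sum_mul]
        rw [integral_finsetSum (f := fun k ω => x k ω * x (N + 1) ω) _
          fun k _ => (hx2 k).integrable_mul (hx2 (N + 1))]
        exact Finset.sum_eq_zero fun k hk => horth _ _ (by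
          have := (Finset.mem_Icc.1 hk).2; omega)
      have hlast : ∫ ω, x (N + 1) ω ^ 2 ∂μ ≤ C ^ 2 := by
        have : ∫ ω, x (N + 1) ω ^ 2 ∂μ ≤ ∫ _, C ^ 2 ∂μ := by
          refine integral_mono_ae (hx2 _).integrable_sq (integrable_const _) ?_
          filter_upwards [hC (N + 1)] with ω hω
          rw [← sq_abs]
          exact pow_le_pow_left₀ (abs_nonneg _) hω 2
        simpa using this
      have hi : Integrable (fun ω => S N ω * x (N + 1) ω) μ :=
        (hS2 N).integrable_mul (hx2 (N + 1))
      have hsq := (hS2 N).integrable_sq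
      have hadd : Integrable (fun ω => S N ω ^ 2 + 2 * (S N ω * x (N + 1) ω)) μ :=
        hsq.add (hi.const_mul 2)
      have hexp : ∫ ω, S (N + 1) ω ^ 2 ∂μ = ∫ ω, S N ω ^ 2 ∂μ
          + 2 * ∫ ω, S N ω * x (N + 1) ω ∂μ + ∫ ω, x (N + 1) ω ^ 2 ∂μ := by
        rw [← integral_const_mul, ← integral_add hsq (hi.const_mul 2),
          ← integral_add hadd (hx2 (N + 1)).integrable_sq]
        exact integral_congr_ae (Eventually.of_forall hS)
      rw [hexp, hcross]
      push_cast
      linarith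
  let q : ℕ → Ω → ℝ := fun n ω => (cesaro (fun k => x k ω) (n ^ 2)) ^ 2
  have hqS : ∀ n ω, q n ω = (1 / ((n ^ 2 : ℕ) : ℝ)) ^ 2 * S (n ^ 2) ω ^ 2 := by
    intro n ω
    simp only [q, cesaro, S, mul_pow]
  have hqi : ∀ n, Integrable (q n) μ := fun n => by
    rw [show q n = fun ω => _ from funext (hqS n)]
    exact (hS2 _).integrable_sq.const_mul _
  have hqint : ∀ n : ℕ, ∫ ω, q n ω ∂μ ≤ C ^ 2 * (1 / (n : ℝ) ^ 2) := by
    intro n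
    simp only [hqS]
    rw [integral_const_mul]
    refine (mul_le_mul_of_nonneg_left (hvar (n ^ 2)) (by positivity)).trans (le_of_eq ?_)
    rcases Nat.eq_zero_or_pos n with rfl | hn
    · simp
    · have : (n : ℝ) ≠ 0 := by positivity
      push_cast
      field_simp
  have hsum : ∑' n, ENNReal.ofReal (∫ ω, q n ω ∂μ) ≠ ⊤ := by
    have hs : Summable fun n : ℕ => C ^ 2 * (1 / (n : ℝ) ^ 2) :=
      (Real.summable_one_div_nat_pow.2 one_lt_two).mul_left _
    refine ne_top_of_le_ne_top hs.tsum_ofReal_ne_top ?_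
    exact ENNReal.tsum_le_tsum fun n => ENNReal.ofReal_le_ofReal (hqint n)
  have hlint : ∫⁻ ω, ∑' n, ENNReal.ofReal (q n ω) ∂μ ≠ ⊤ := by
    rw [lintegral_tsum fun n => (hqi n).aemeasurable.ennreal_ofReal]
    convert hsum using 3 with n
    rw [ofReal_integral_eq_lintegral_ofReal (hqi n) (Eventually.of_forall fun ω => sq_nonneg _)]
  have hfin := ae_lt_top' (AEMeasurable.tsum fun n => (hqi n).aemeasurable.ennreal_ofReal)
    hlint
  filter_upwards [hfin, ae_all_iff.2 hC] with ω h1 h2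
  refine tendsto_cesaro_of_tendsto_sq (C := C) (fun k _ => h2 k) ?_
  have h3 := ENNReal.tendsto_atTop_zero_of_tsum_ne_top h1.ne
  have h4 : Tendsto (fun n => q n ω) atTop (𝓝 0) := by
    have := (ENNReal.tendsto_toReal ENNReal.zero_ne_top).comp h3
    refine this.congr fun n => ?_
    simp [q, ENNReal.toReal_ofReal, sq_nonneg]
  have h5 := (Real.continuous_sqrt.tendsto 0).comp h4
  rw [Real.sqrt_zero] at h5
  refine (tendsto_zero_iff_abs_tendsto_zero _).2 (h5.congr fun n => ?_)
  simp [q, Real.sqrt_sq_eq_abs]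

/-! ### Conditional expectations along a filtration generated by the shift -/

section MartingaleDifferences

variable {Ω : Type*} {m m₁ m₂ mΩ : MeasurableSpace Ω} {μ : Measure Ω}

theorem abs_condExp_le_condExp {f g : Ω → ℝ} (hf : Integrable f μ) (hg : Integrable g μ)
    (h : ∀ᵐ ω ∂μ, |f ω| ≤ g ω) : ∀ᵐ ω ∂μ, |(μ[f | m]) ω| ≤ (μ[g | m]) ω := by
  have h1 : μ[f | m] ≤ᵐ[μ] μ[g | m] :=
    condExp_mono hf hg (by filter_upwards [h] with ω hω using (le_abs_self _).trans hω)
  have h2 : μ[-f | m] ≤ᵐ[μ] μ[g | m] :=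
    condExp_mono hf.neg hg (by filter_upwards [h] with ω hω using (neg_le_abs _).trans hω)
  filter_upwards [h1, h2, condExp_neg f m (μ := μ)] with ω h3 h4 h5
  rw [h5] at h4
  exact abs_le'.2 ⟨h3, h4⟩

/-- The law of large numbers for bounded stationary-filtration martingale differences. -/
theorem ae_tendsto_cesaro_condExp_sub_of_bounded [IsProbabilityMeasure μ] {T : Ω ≃ᵐ Ω}
    (hT : MeasurePreserving T μ μ) (h12 : m₁ ≤ m₂) (h2 : m₂ ≤ mΩ) (hshift : m₂ ≤ m₁.comap T)
    {f : ℕ → Ω → ℝ} {C : ℝ}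
    (hC : ∀ k, ∀ᵐ ω ∂μ, |f k ω| ≤ C) :
    ∀ᵐ ω ∂μ, Tendsto (cesaro fun k => (μ[f k | m₂]) (T^[k] ω) - (μ[f k | m₁]) (T^[k] ω))
      atTop (𝓝 0) := by
  have h1 : m₁ ≤ mΩ := h12.trans h2
  let X : ℕ → Ω → ℝ := fun k => μ[f k | m₂] - μ[f k | m₁]
  have hXm : ∀ k, StronglyMeasurable[m₂] (X k) := fun k =>
    stronglyMeasurable_condExp.sub (stronglyMeasurable_condExp.mono h12)
  have hXm' : ∀ k, StronglyMeasurable (X k) := fun k => (hXm k).mono h2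
  have hXi : ∀ k, Integrable (X k) μ := fun k => integrable_condExp.sub integrable_condExp
  have hXC : ∀ k, ∀ᵐ ω ∂μ, |X k ω| ≤ 2 * C := by
    intro k
    filter_upwards [ae_bdd_abs_condExp_of_ae_bdd_abs (m := m₁) (hC k),
      ae_bdd_abs_condExp_of_ae_bdd_abs (m := m₂) (hC k)] with ω h3 h4
    rw [two_mul]
    exact (abs_sub _ _).trans (add_le_add h4 h3)
  have hX0 : ∀ k, μ[X k | m₁] =ᵐ[μ] 0 := by
    intro k
    filter_upwards [condExp_sub (integrable_condExp (μ := μ) (f := f k) (m := m₂))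
      (integrable_condExp (μ := μ) (f := f k) (m := m₁)) m₁,
      condExp_condExp_of_le (μ := μ) (f := f k) h12 h2,
      condExp_condExp_of_le (μ := μ) (f := f k) le_rfl h1] with ω h3 h4 h5
    rw [h3, Pi.sub_apply, h4, h5, sub_self, Pi.zero_apply]
  -- Composition with `T⁻¹` makes an `m₂`-measurable function `m₁`-measurable: earlier terms belong
  -- to the past of later ones.
  have hsymm : Measurable[m₁, m₂] T.symm := by
    intro s hs
    obtain ⟨b, hb, rfl⟩ := hshift s hs
    rw [← Set.preimage_comp]
    simpa using hb
  have hsymm₁ : Measurable[m₁, m₁] T.symm := fun s hs => hsymm (h12 s hs)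
  have hiter : ∀ p : ℕ, Measurable[m₁, m₂] T.symm^[p + 1] := by
    intro p
    rw [Function.iterate_succ']
    exact hsymm.comp (hsymm₁.iterate p)
  have hinv : ∀ (p k : ℕ) (ω : Ω), T.symm^[p] (T^[p + k] ω) = T^[k] ω := by
    intro p k ω
    rw [Function.iterate_add_apply]
    exact (Function.LeftInverse.iterate T.symm_apply_apply p) _
  have hps : ∀ p, MeasurePreserving T.symm^[p] μ μ := fun p => (hT.symm T).iterate p
  refine ae_tendsto_cesaro_of_orthogonal (x := fun k ω => X k (T^[k] ω)) (C := 2 * C)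
    (fun k => ((hXm' k).comp_measurable (hT.iterate k).measurable).aestronglyMeasurable)
    (fun k => (hT.iterate k).quasiMeasurePreserving.ae (hXC k)) fun k l hkl => ?_
  obtain ⟨p, rfl⟩ := Nat.exists_eq_add_of_lt hkl
  -- Shifting time by `-(k + p + 1)` turns the earlier term into `Z`, which is `m₁`-measurable,
  -- while the later term becomes `X (k + p + 1)`, which is centred given `m₁`.
  let Z : Ω → ℝ := fun ω => X k (T.symm^[p + 1] ω)
  have hZ : StronglyMeasurable[m₁] Z := (hXm k).comp_measurable (hiter p)
  have hZC : ∀ᵐ ω ∂μ, ‖Z ω‖ ≤ 2 * C := (hps (p + 1)).quasiMeasurePreserving.ae (hXC k)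
  have hZX : Integrable (Z * X (k + p + 1)) μ :=
    (hXi _).bdd_mul (hZ.mono h1).aestronglyMeasurable hZC
  have hre : ∫ ω, X k (T^[k] ω) * X (k + p + 1) (T^[k + p + 1] ω) ∂μ
      = ∫ ω, (Z * X (k + p + 1)) ω ∂μ := by
    rw [← integral_comp_of_measurePreserving (hT.iterate (k + p + 1)) hZX.aestronglyMeasurable]
    refine integral_congr_ae (Eventually.of_forall fun ω => ?_)
    simp only [Pi.mul_apply, Z]
    rw [show k + p + 1 = p + 1 + k by ring, hinv]
  rw [hre, ← integral_condExp h1]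
  refine integral_eq_zero_of_ae ?_
  filter_upwards [condExp_mul_of_stronglyMeasurable_left hZ hZX (hXi _), hX0 (k + p + 1)]
    with ω h3 h4
  rw [h3, Pi.mul_apply, h4, Pi.zero_apply, mul_zero]

/-- The law of large numbers for the martingale differences `E[f_k | m₂] - E[f_k | m₁]`, moved
along the orbit, when the `f_k` are dominated by one integrable function. -/
theorem ae_tendsto_cesaro_condExp_sub [IsProbabilityMeasure μ] {T : Ω ≃ᵐ Ω} (hT : Ergodic T μ)
    (h12 : m₁ ≤ m₂) (h2 : m₂ ≤ mΩ) (hshift : m₂ ≤ m₁.comap T)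
    {f : ℕ → Ω → ℝ} {Λ : Ω → ℝ} (hf : ∀ k, AEStronglyMeasurable (f k) μ)
    (hΛ : Integrable Λ μ) (hfΛ : ∀ k, ∀ᵐ ω ∂μ, |f k ω| ≤ Λ ω) :
    ∀ᵐ ω ∂μ, Tendsto (cesaro fun k => (μ[f k | m₂]) (T^[k] ω) - (μ[f k | m₁]) (T^[k] ω))
      atTop (𝓝 0) := by
  have hfi : ∀ k, Integrable (f k) μ := fun k => hΛ.mono' (hf k) (hfΛ k)
  have hTp := hT.toMeasurePreserving
  -- Truncation at level `n` costs at most `r n = (Λ - n)⁺`, simultaneously for all `k`.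
  let g : ℕ → ℕ → Ω → ℝ := fun n k ω => max (-(n : ℝ)) (min (f k ω) n)
  have hgm : ∀ n k, AEStronglyMeasurable (g n k) μ := fun n k =>
    ((measurable_const.max (measurable_id.min measurable_const)).comp_aemeasurable
      (hf k).aemeasurable).aestronglyMeasurable
  have hgC : ∀ n k, ∀ᵐ ω ∂μ, |g n k ω| ≤ n := fun n k => Eventually.of_forall fun ω =>
    abs_le.2 ⟨le_max_left _ _, max_le (by linarith [n.cast_nonneg (α := ℝ)]) (min_le_right _ _)⟩
  have hgi : ∀ n k, Integrable (g n k) μ := fun n k => Integrable.of_bound (hgm n k) n (hgC n k)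
  let r : ℕ → Ω → ℝ := fun n ω => max 0 (Λ ω - n)
  have hr0 : ∀ n ω, 0 ≤ r n ω := fun n ω => le_max_left _ _
  have hri : ∀ n, Integrable (r n) μ := fun n => by
    refine (hΛ.sub (integrable_const (n : ℝ))).pos_part.congr (Eventually.of_forall fun ω => ?_)
    simp [r, max_comm]
  have hrlim : Tendsto (fun n => ∫ ω, r n ω ∂μ) atTop (𝓝 0) := by
    have h := tendsto_integral_of_dominated_convergence (F := r) (f := fun _ => (0 : ℝ))
      (fun ω => |Λ ω|) (fun n => (hri n).aestronglyMeasurable) hΛ.abs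
      (fun n => Eventually.of_forall fun ω => ?_) (Eventually.of_forall fun ω => ?_)
    · simpa using h
    · rw [Real.norm_of_nonneg (hr0 n ω)]
      exact max_le (abs_nonneg _) (by linarith [le_abs_self (Λ ω), n.cast_nonneg (α := ℝ)])
    · refine tendsto_const_nhds.congr' ?_
      filter_upwards [tendsto_natCast_atTop_atTop.eventually_ge_atTop (Λ ω)] with n hn
      exact (max_eq_left (by linarith)).symm
  have hdiff : ∀ n k, ∀ᵐ ω ∂μ, |(f k - g n k) ω| ≤ r n ω := by
    intro n k
    filter_upwards [hfΛ k] with ω hω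
    have hn := n.cast_nonneg (α := ℝ)
    obtain ⟨ha, hb⟩ := abs_le.1 hω
    simp only [Pi.sub_apply, g, r]
    rcases min_cases (f k ω) n with ⟨h3, h4⟩ | ⟨h3, h4⟩ <;> rw [h3]
    · rcases max_cases (-(n : ℝ)) (f k ω) with ⟨h5, h6⟩ | ⟨h5, h6⟩ <;> rw [h5]
      · rw [abs_of_nonpos (by linarith)]
        exact le_max_of_le_right (by linarith)
      · simp
    · rw [max_eq_right (by linarith), abs_of_nonneg (by linarith)]
      exact le_max_of_le_right (by linarith)
  have hcond : ∀ (m' : MeasurableSpace Ω) (n k : ℕ),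
      ∀ᵐ ω ∂μ, |(μ[f k | m']) ω - (μ[g n k | m']) ω| ≤ (μ[r n | m']) ω := by
    intro m' n k
    filter_upwards [abs_condExp_le_condExp (m := m') ((hfi k).sub (hgi n k)) (hri n) (hdiff n k),
      condExp_sub (hfi k) (hgi n k) m'] with ω h3 h4
    rwa [h4] at h3
  refine ae_tendsto_cesaro_of_approx hT
    (y := fun n k ω => (μ[g n k | m₂]) (T^[k] ω) - (μ[g n k | m₁]) (T^[k] ω))
    (h := fun n => μ[r n | m₂] + μ[r n | m₁])
    (fun n => integrable_condExp.add integrable_condExp) ?_ ?_ fun n =>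
      ae_tendsto_cesaro_condExp_sub_of_bounded hTp h12 h2 hshift (hgC n)
  · have h3 : ∀ n, ∫ ω, (μ[r n | m₂] + μ[r n | m₁]) ω ∂μ = ∫ ω, r n ω ∂μ + ∫ ω, r n ω ∂μ := by
      intro n
      rw [integral_add' integrable_condExp integrable_condExp, integral_condExp h2,
        integral_condExp (h12.trans h2)]
    simp only [h3]
    simpa using hrlim.add hrlim
  · intro n k _
    refine (hTp.iterate k).quasiMeasurePreserving.ae (p := fun ω =>
      |(μ[f k | m₂]) ω - (μ[f k | m₁]) ω - ((μ[g n k | m₂]) ω - (μ[g n k | m₁]) ω)|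
        ≤ (μ[r n | m₂] + μ[r n | m₁]) ω) ?_
    filter_upwards [hcond m₁ n k, hcond m₂ n k] with ω h3 h4
    rw [sub_sub_sub_comm]
    exact (abs_sub _ _).trans (add_le_add h4 h3)

end MartingaleDifferences

/-! ### Telescoping martingale differences through a decreasing family of fields -/

section MartingaleTelescope

variable {Ω : Type*} {m mΩ : MeasurableSpace Ω} {μ : Measure Ω} [IsProbabilityMeasure μ]

/-- The difference telescopes into `j` one-step increments, each covered by the law of large numbers
for martingale differences. -/
theorem ae_tendsto_cesaro_condExp_sub_add {T : Ω ≃ᵐ Ω} (hT : Ergodic T μ)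
    {𝒢 : ℤ → MeasurableSpace Ω} (hle : ∀ n, 𝒢 n ≤ mΩ) (hanti : ∀ n, 𝒢 (n + 1) ≤ 𝒢 n)
    (hshift : ∀ n, 𝒢 n ≤ (𝒢 (n + 1)).comap T)
    {f : ℕ → Ω → ℝ} {Λ : Ω → ℝ} (hf : ∀ k, AEStronglyMeasurable (f k) μ)
    (hΛ : Integrable Λ μ) (hfΛ : ∀ k, ∀ᵐ ω ∂μ, |f k ω| ≤ Λ ω) (a : ℤ) (j : ℕ) :
    ∀ᵐ ω ∂μ, Tendsto (cesaro fun k => (μ[f k | 𝒢 a]) (T^[k] ω) - (μ[f k | 𝒢 (a + j)]) (T^[k] ω))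
      atTop (𝓝 0) := by
  induction j with
  | zero =>
    refine Eventually.of_forall fun ω => ?_
    simp only [Nat.cast_zero, add_zero, sub_self]
    exact tendsto_cesaro_of_tendsto tendsto_const_nhds
  | succ j ih =>
    have hstep := ae_tendsto_cesaro_condExp_sub hT (hanti (a + j)) (hle _) (hshift (a + j))
      hf hΛ hfΛ
    filter_upwards [ih, hstep] with ω h1 h2
    rw [← add_zero (0 : ℝ)]
    refine (h1.add h2).congr fun N => ?_
    rw [← cesaro_add]
    refine cesaro_congr (fun k _ => ?_) N
    push_cast
    rw [← add_assoc]
    ring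

/-- If the `f k` are uniformly approximated in `L¹` by their conditional expectations given the
fields `𝒢 (-n)`, and `E[f k | m]` by those given `𝒢 n`, then `f k` and `E[f k | m]` have the same
averages along the orbit. -/
theorem ae_tendsto_cesaro_sub_condExp {T : Ω ≃ᵐ Ω} (hT : Ergodic T μ)
    {𝒢 : ℤ → MeasurableSpace Ω} (hle : ∀ n, 𝒢 n ≤ mΩ) (hanti : ∀ n, 𝒢 (n + 1) ≤ 𝒢 n)
    (hshift : ∀ n, 𝒢 n ≤ (𝒢 (n + 1)).comap T)
    {f : ℕ → Ω → ℝ} {Λ : Ω → ℝ} (hf : ∀ k, AEStronglyMeasurable (f k) μ)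
    (hΛ : Integrable Λ μ) (hfΛ : ∀ k, ∀ᵐ ω ∂μ, |f k ω| ≤ Λ ω)
    {D D' : ℕ → Ω → ℝ} (hDi : ∀ n, Integrable (D n) μ) (hDi' : ∀ n, Integrable (D' n) μ)
    (hD0 : Tendsto (fun n => ∫ ω, D n ω ∂μ) atTop (𝓝 0))
    (hD0' : Tendsto (fun n => ∫ ω, D' n ω ∂μ) atTop (𝓝 0))
    (hD : ∀ n k : ℕ, ∀ᵐ ω ∂μ, |(μ[f k | 𝒢 (-n)]) ω - f k ω| ≤ D n ω)
    (hD' : ∀ n k : ℕ, ∀ᵐ ω ∂μ, |(μ[f k | 𝒢 n]) ω - (μ[f k | m]) ω| ≤ D' n ω) :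
    ∀ᵐ ω ∂μ, Tendsto (cesaro fun k => f k (T^[k] ω) - (μ[f k | m]) (T^[k] ω)) atTop (𝓝 0) := by
  refine ae_tendsto_cesaro_of_approx hT
    (y := fun n k ω => (μ[f k | 𝒢 (-n)]) (T^[k] ω) - (μ[f k | 𝒢 n]) (T^[k] ω))
    (h := fun n => D n + D' n) (fun n => (hDi n).add (hDi' n)) ?_ ?_ ?_
  · simp only [integral_add' (hDi _) (hDi' _)]
    simpa using hD0.add hD0'
  · intro n k _
    refine (hT.toMeasurePreserving.iterate k).quasiMeasurePreserving.ae (p := fun ω =>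
      |f k ω - (μ[f k | m]) ω - ((μ[f k | 𝒢 (-n)]) ω - (μ[f k | 𝒢 n]) ω)| ≤ (D n + D' n) ω) ?_
    filter_upwards [hD n k, hD' n k] with ω h1 h2
    rw [abs_sub_comm] at h1
    calc _ = |(f k ω - (μ[f k | 𝒢 (-n)]) ω) + ((μ[f k | 𝒢 n]) ω - (μ[f k | m]) ω)| := by ring_nf
      _ ≤ _ := (abs_add_le _ _).trans (add_le_add h1 h2)
  · intro n
    -- From `-n` to `n` there are `n + n` increments, a number that does not depend on `k`.
    have h := ae_tendsto_cesaro_condExp_sub_add hT hle hanti hshift hf hΛ hfΛ (-n) (n + n)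
    rwa [show (-(n : ℤ) + ((n + n : ℕ) : ℤ)) = n by push_cast; ring] at h

end MartingaleTelescope

/-- Sets of `m.comap S` are preimages `S⁻¹ b`, and invariance of `μ` turns integrals over them into
integrals over `b`. -/
theorem condExp_comp_of_measurePreserving {Ω : Type*} {m mΩ : MeasurableSpace Ω} {μ : Measure Ω}
    [IsFiniteMeasure μ] {S : Ω → Ω} (hS : MeasurePreserving S μ μ) (hm : m ≤ mΩ) {f : Ω → ℝ}
    (hf : Integrable f μ) :
    μ[fun ω => f (S ω) | m.comap S] =ᵐ[μ] fun ω => (μ[f | m]) (S ω) := by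
  have hc : m.comap S ≤ mΩ := (MeasurableSpace.comap_mono hm).trans hS.measurable.comap_le
  have hset : ∀ (g : Ω → ℝ), Integrable g μ → ∀ b, MeasurableSet b →
      ∫ ω in S ⁻¹' b, g (S ω) ∂μ = ∫ ω in b, g ω ∂μ := by
    intro g hg b hb
    have := setIntegral_map (μ := μ) (g := S) hb (f := g)
      (by rw [hS.map_eq]; exact hg.aestronglyMeasurable) hS.measurable.aemeasurable
    rw [← this, hS.map_eq]
  symm
  refine ae_eq_condExp_of_forall_setIntegral_eq hc (hS.integrable_comp_of_integrable hf)
    (fun s _ _ => (hS.integrable_comp_of_integrable integrable_condExp).integrableOn) ?_ ?_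
  · rintro _ ⟨b, hb, rfl⟩ _
    rw [hset _ integrable_condExp b (hm b hb), hset f hf b (hm b hb), setIntegral_condExp hm hf hb]
  · exact (stronglyMeasurable_condExp.comp_measurable
      (comap_measurable S)).aestronglyMeasurable

/-! ### Essential suprema and infima of dominated families -/

section EssentialSupremum

variable {Ω ι : Type*} {mΩ : MeasurableSpace Ω} {μ : Measure Ω} [IsFiniteMeasure μ]
  {S : Set ι} {f : ι → Ω → ℝ} {H : Ω → ℝ}

/-- The bound `H` guarantees that the essential supremum exists, so that the default value `0` of
`familyEssSup` is not in play. -/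
theorem le_familyEssSup (hf : ∀ i ∈ S, AEMeasurable (f i) μ)
    (hH : ∀ i ∈ S, ∀ᵐ ω ∂μ, |f i ω| ≤ H ω) {i : ι} (hi : i ∈ S) :
    f i ≤ᵐ[μ] familyEssSup μ S f :=
  (isFamilyEssSup_familyEssSup μ ⟨i, hi⟩ hf fun j hj => by
    filter_upwards [hH j hj] with ω h using (le_abs_self _).trans h).le i hi

theorem abs_familyEssSup_le (hS : S.Nonempty) (hf : ∀ i ∈ S, AEMeasurable (f i) μ)
    (hHm : AEMeasurable H μ) (hH : ∀ i ∈ S, ∀ᵐ ω ∂μ, |f i ω| ≤ H ω) :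
    ∀ᵐ ω ∂μ, |familyEssSup μ S f ω| ≤ H ω := by
  have hle : ∀ i ∈ S, f i ≤ᵐ[μ] H := fun j hj => by
    filter_upwards [hH j hj] with ω h using (le_abs_self _).trans h
  have h1 := (isFamilyEssSup_familyEssSup μ hS hf hle).least H hHm hle
  obtain ⟨i, hi⟩ := hS
  filter_upwards [h1, le_familyEssSup hf hH hi, hH i hi] with ω h2 h3 h4
  exact abs_le.2 ⟨(abs_le.1 h4).1.trans h3, h2⟩

theorem integrable_familyEssSup (hS : S.Nonempty) (hf : ∀ i ∈ S, AEMeasurable (f i) μ)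
    (hHi : Integrable H μ) (hH : ∀ i ∈ S, ∀ᵐ ω ∂μ, |f i ω| ≤ H ω) :
    Integrable (familyEssSup μ S f) μ :=
  hHi.mono' (isFamilyEssSup_familyEssSup μ hS hf fun j hj => by
    filter_upwards [hH j hj] with ω h using (le_abs_self _).trans h).aemeasurable.aestronglyMeasurable
    (abs_familyEssSup_le hS hf hHi.aemeasurable hH)

theorem familyEssInf_le (hf : ∀ i ∈ S, AEMeasurable (f i) μ)
    (hH : ∀ i ∈ S, ∀ᵐ ω ∂μ, |f i ω| ≤ H ω) {i : ι} (hi : i ∈ S) :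
    familyEssInf μ S f ≤ᵐ[μ] f i := by
  filter_upwards [le_familyEssSup (f := fun i ω => -f i ω) (H := H) (fun j hj => (hf j hj).neg)
    (fun j hj => by simpa using hH j hj) hi] with ω h
  exact neg_le.1 h

theorem abs_familyEssInf_le (hS : S.Nonempty) (hf : ∀ i ∈ S, AEMeasurable (f i) μ)
    (hHm : AEMeasurable H μ) (hH : ∀ i ∈ S, ∀ᵐ ω ∂μ, |f i ω| ≤ H ω) :
    ∀ᵐ ω ∂μ, |familyEssInf μ S f ω| ≤ H ω := by
  simpa [familyEssInf] using abs_familyEssSup_le (f := fun i ω => -f i ω) hS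
    (fun j hj => (hf j hj).neg) hHm (fun j hj => by simpa using hH j hj)

theorem integrable_familyEssInf (hS : S.Nonempty) (hf : ∀ i ∈ S, AEMeasurable (f i) μ)
    (hHi : Integrable H μ) (hH : ∀ i ∈ S, ∀ᵐ ω ∂μ, |f i ω| ≤ H ω) :
    Integrable (familyEssInf μ S f) μ :=
  (integrable_familyEssSup (f := fun i ω => -f i ω) hS (fun j hj => (hf j hj).neg) hHi
    (fun j hj => by simpa using hH j hj)).neg

/-- A sequence that stays above an essential infimum, and eventually below each member of the
family up to a vanishing error, converges to that essential infimum. -/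
theorem ae_tendsto_familyEssInf (hS : S.Nonempty) (hf : ∀ i ∈ S, AEMeasurable (f i) μ)
    (hH : ∀ i ∈ S, ∀ᵐ ω ∂μ, |f i ω| ≤ H ω) {b δ : ℕ → Ω → ℝ}
    (hδ : ∀ᵐ ω ∂μ, Tendsto (fun k => δ k ω) atTop (𝓝 0))
    (hlo : ∀ k, familyEssInf μ S f ≤ᵐ[μ] b k)
    (hup : ∀ i ∈ S, ∃ m : ℕ, ∀ k, m ≤ k → ∀ᵐ ω ∂μ, b k ω ≤ f i ω + δ k ω) :
    ∀ᵐ ω ∂μ, Tendsto (fun k => b k ω) atTop (𝓝 (familyEssInf μ S f ω)) := by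
  have hfn : ∀ i ∈ S, AEMeasurable (fun ω => -f i ω) μ := fun j hj => (hf j hj).neg
  have hHn : ∀ i ∈ S, (fun ω => -f i ω) ≤ᵐ[μ] H := fun j hj => by
    filter_upwards [hH j hj] with ω h using (neg_le_abs _).trans h
  -- A countable subfamily attains the essential supremum, so only countably many exceptional null
  -- sets from `hup` have to be discarded.
  obtain ⟨c, hcS, hc⟩ := exists_isFamilyEssSup μ hS hfn hHn
  have hg := isFamilyEssSup_familyEssSup μ hS hfn hHn
  have hle : familyEssSup μ S (fun i ω => -f i ω) ≤ᵐ[μ] fun ω => ⨆ n, -f (c n) ω :=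
    hg.least _ hc.aemeasurable hc.le
  choose m hm using fun n => hup (c n) (hcS n)
  have hup' : ∀ᵐ ω ∂μ, ∀ n k, m n ≤ k → b k ω ≤ f (c n) ω + δ k ω := by
    refine ae_all_iff.2 fun n => ae_all_iff.2 fun k => ?_
    by_cases hk : m n ≤ k
    · filter_upwards [hm n k hk] with ω hω _ using hω
    · exact Eventually.of_forall fun ω h => absurd h hk
  filter_upwards [hδ, ae_all_iff.2 hlo, hup', hle] with ω h1 h2 h3 h4
  rw [Metric.tendsto_nhds]
  intro ε hε
  have h5 : -familyEssInf μ S f ω - ε / 2 < ⨆ n, -f (c n) ω := by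
    simp only [familyEssInf, neg_neg]
    linarith
  obtain ⟨n, hn⟩ := exists_lt_of_lt_ciSup h5
  filter_upwards [eventually_ge_atTop (m n), h1.eventually_lt_const (half_pos hε)] with k h6 h7
  have h8 := h3 n k h6
  have h9 := h2 k
  rw [Real.dist_eq, abs_of_nonneg (by linarith)]
  linarith

end EssentialSupremum

/-! ### Shifted fields, decisions and losses -/

section Fields

variable {Ω U : Type*} {𝒴 𝒳 𝒢 : MeasurableSpace Ω}

theorem shiftField_comap (T : Equiv.Perm Ω) (k j : ℤ) (𝒢 : MeasurableSpace Ω) :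
    (shiftField T k 𝒢).comap (⇑(T ^ j)) = shiftField T (k + j) 𝒢 := by
  rw [shiftField, shiftField, MeasurableSpace.comap_comp, zpow_add, Equiv.Perm.coe_mul]

theorem obsField_comap (T : Equiv.Perm Ω) (j m n : ℤ) (𝒴 : MeasurableSpace Ω) :
    (obsField T 𝒴 (Set.Icc m n)).comap (⇑(T ^ j)) = obsField T 𝒴 (Set.Icc (m + j) (n + j)) := by
  simp only [obsField, MeasurableSpace.comap_iSup, shiftField_comap]
  refine le_antisymm (iSup₂_le fun k hk => ?_) (iSup₂_le fun k hk => ?_)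
  · exact le_iSup₂_of_le (k + j) ⟨add_le_add_left hk.1 _, add_le_add_left hk.2 _⟩ le_rfl
  · refine le_iSup₂_of_le (k - j) ⟨by linarith [hk.1], by linarith [hk.2]⟩ ?_
    rw [sub_add_cancel]

theorem obsField_mono (T : Equiv.Perm Ω) (𝒴 : MeasurableSpace Ω) {I J : Set ℤ} (h : I ⊆ J) :
    obsField T 𝒴 I ≤ obsField T 𝒴 J :=
  biSup_mono h

theorem decisions_mono (T : Equiv.Perm Ω) (𝒴 : MeasurableSpace Ω) [MeasurableSpace U]
    {m m' n : ℤ} (h : m' ≤ m) : decisions T 𝒴 U m n ⊆ decisions T 𝒴 U m' n :=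
  fun _ hu _ hs => obsField_mono T 𝒴 (Set.Icc_subset_Icc_left h) _ (hu hs)

theorem comp_zpow_mem_decisions (T : Equiv.Perm Ω) [MeasurableSpace U] {m n : ℤ} {u : Ω → U}
    (hu : u ∈ decisions T 𝒴 U m n) (j : ℤ) :
    u ∘ ⇑(T ^ j) ∈ decisions T 𝒴 U (m + j) (n + j) := by
  intro s hs
  rw [← obsField_comap]
  exact ⟨u ⁻¹' s, hu hs, rfl⟩

theorem shiftField_mono_index (T : Equiv.Perm Ω) (h : 𝒳 ≤ shiftField T 1 𝒳) (k : ℤ) :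
    shiftField T k 𝒳 ≤ shiftField T (k + 1) 𝒳 := by
  rw [add_comm, ← shiftField_comap]
  exact MeasurableSpace.comap_mono h

/-- Applying `T^{n+1}` to `𝒳 ⊆ T^{-1} 𝒳` gives `T^{n+1} 𝒳 ⊆ T^n 𝒳`. -/
theorem pastField_succ_le (T : Equiv.Perm Ω) (h : 𝒳 ≤ shiftField T 1 𝒳) (n : ℤ) :
    pastField T 𝒴 𝒳 (n + 1) ≤ pastField T 𝒴 𝒳 n := by
  refine sup_le_sup le_rfl ?_
  have := shiftField_mono_index T h (-(n + 1))
  rwa [show -(n + 1) + 1 = -n by ring] at this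

/-- `T^{-1}` sends `T^{n+1} 𝒳` to `T^n 𝒳` and `𝒴_{-∞,0}` to the larger `𝒴_{-∞,1}`. This is what
makes the increments, moved along the orbit, martingale differences. -/
theorem pastField_le_comap (T : Equiv.Perm Ω) (n : ℤ) :
    pastField T 𝒴 𝒳 n ≤ (pastField T 𝒴 𝒳 (n + 1)).comap T := by
  have hsh : ∀ (k : ℤ) (𝒢 : MeasurableSpace Ω),
      (shiftField T k 𝒢).comap T = shiftField T (k + 1) 𝒢 := fun k 𝒢 => by
    rw [← shiftField_comap, zpow_one]
  rw [pastField, pastField, MeasurableSpace.comap_sup, hsh,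
    show -(n + 1) + 1 = -n by ring]
  refine sup_le_sup (iSup₂_le fun k hk => ?_) le_rfl
  rw [← sub_add_cancel k 1, ← hsh]
  exact MeasurableSpace.comap_mono
    (le_iSup₂_of_le (k - 1) (by simp only [Set.mem_Iic] at hk ⊢; omega) le_rfl)

theorem lossAt_comp_zpow (T : Equiv.Perm Ω) (ℓ : U → Ω → ℝ) (k : ℤ) (u : Ω → U) :
    lossAt T ℓ k (u ∘ ⇑(T ^ k)) = fun ω => lossAt T ℓ 0 u ((T ^ k) ω) := by
  funext ω
  simp [lossAt]

theorem comp_zpow_neg_comp_zpow (T : Equiv.Perm Ω) (k : ℤ) (u : Ω → U) :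
    (u ∘ ⇑(T ^ (-k))) ∘ ⇑(T ^ k) = u := by
  funext ω
  simp [zpow_neg]

variable [mΩ : MeasurableSpace Ω]

theorem coe_zpow_natCast (T : Ω ≃ᵐ Ω) (k : ℕ) : ⇑(T.toEquiv ^ (k : ℤ)) = T^[k] := by
  rw [zpow_natCast]
  exact (Equiv.Perm.iterate_eq_pow T.toEquiv k).symm

theorem coe_zpow_neg_natCast (T : Ω ≃ᵐ Ω) (k : ℕ) :
    ⇑(T.toEquiv ^ (-(k : ℤ))) = T.symm^[k] := by
  rw [zpow_neg, zpow_natCast, ← inv_pow]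
  exact (Equiv.Perm.iterate_eq_pow T.symm.toEquiv k).symm

theorem measurePreserving_zpow {μ : Measure Ω} {T : Ω ≃ᵐ Ω} (hT : MeasurePreserving T μ μ)
    (k : ℤ) : MeasurePreserving (⇑(T.toEquiv ^ k)) μ μ := by
  obtain ⟨n, rfl | rfl⟩ := k.eq_nat_or_neg
  · rw [coe_zpow_natCast]
    exact hT.iterate n
  · rw [coe_zpow_neg_natCast]
    exact (hT.symm T).iterate n

theorem measurable_zpow (T : Ω ≃ᵐ Ω) (k : ℤ) : Measurable (⇑(T.toEquiv ^ k)) := by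
  obtain ⟨n, rfl | rfl⟩ := k.eq_nat_or_neg
  · rw [coe_zpow_natCast]
    exact T.measurable.iterate n
  · rw [coe_zpow_neg_natCast]
    exact T.symm.measurable.iterate n

theorem shiftField_le (T : Ω ≃ᵐ Ω) (h : 𝒢 ≤ mΩ) (k : ℤ) : shiftField T.toEquiv k 𝒢 ≤ mΩ :=
  (MeasurableSpace.comap_mono h).trans (measurable_zpow T k).comap_le

theorem obsField_le (T : Ω ≃ᵐ Ω) (h : 𝒴 ≤ mΩ) (I : Set ℤ) : obsField T.toEquiv 𝒴 I ≤ mΩ :=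
  iSup₂_le fun k _ => shiftField_le T h k

theorem pastField_le (T : Ω ≃ᵐ Ω) (h𝒴 : 𝒴 ≤ mΩ) (h𝒳 : 𝒳 ≤ mΩ) (n : ℤ) :
    pastField T.toEquiv 𝒴 𝒳 n ≤ mΩ :=
  sup_le (obsField_le T h𝒴 _) (shiftField_le T h𝒳 _)

theorem measurable_lossAt (T : Ω ≃ᵐ Ω) [MeasurableSpace U] {ℓ : U → Ω → ℝ}
    (hℓ : Measurable fun p : U × Ω => ℓ p.1 p.2) (k : ℤ) {u : Ω → U} (hu : Measurable u) :
    Measurable (lossAt T.toEquiv ℓ k u) :=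
  hℓ.comp (hu.prodMk (measurable_zpow T k))

/-- The change of viewpoint that turns a loss at time `k` into a time-zero loss evaluated along the
orbit. -/
theorem lossAt_eq_comp_iterate (T : Ω ≃ᵐ Ω) (ℓ : U → Ω → ℝ) (k : ℕ) (u : Ω → U) (ω : Ω) :
    lossAt T.toEquiv ℓ k u ω = lossAt T.toEquiv ℓ 0 (u ∘ ⇑(T.toEquiv ^ (-(k : ℤ)))) (T^[k] ω) := by
  rw [← coe_zpow_natCast]
  conv_lhs => rw [← comp_zpow_neg_comp_zpow T.toEquiv k u, lossAt_comp_zpow]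

/-- Conditional expectations given the observations at times `0, …, k`, seen from time `k`. -/
theorem condExp_lossAt_comp_zpow {μ : Measure Ω} [IsFiniteMeasure μ] {T : Ω ≃ᵐ Ω} {ℓ : U → Ω → ℝ}
    (hT : MeasurePreserving T μ μ) (h𝒴 : 𝒴 ≤ mΩ) (k : ℕ) {u : Ω → U}
    (hu : Integrable (lossAt T.toEquiv ℓ 0 u) μ) :
    μ[lossAt T.toEquiv ℓ k (u ∘ ⇑(T.toEquiv ^ (k : ℤ))) | obsField T.toEquiv 𝒴 (Set.Icc 0 (k : ℤ))]
      =ᵐ[μ] fun ω => (μ[lossAt T.toEquiv ℓ 0 u |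
        obsField T.toEquiv 𝒴 (Set.Icc (-(k : ℤ)) 0)]) ((T.toEquiv ^ (k : ℤ)) ω) := by
  have h := condExp_comp_of_measurePreserving (measurePreserving_zpow hT k)
    (obsField_le T h𝒴 (Set.Icc (-(k : ℤ)) 0)) hu
  rwa [obsField_comap, neg_add_cancel, zero_add, ← lossAt_comp_zpow] at h

end Fields

/-! ### Averages of the losses -/

section Losses

variable {Ω U : Type*} {m 𝒴 𝒳 : MeasurableSpace Ω} [mΩ : MeasurableSpace Ω] [MeasurableSpace U]
  {μ : Measure Ω} {T : Ω ≃ᵐ Ω} {ℓ : U → Ω → ℝ} {Λ : Ω → ℝ}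

theorem measurable_of_mem_finiteDecisions (h𝒴 : 𝒴 ≤ mΩ) {n : ℤ} {u : Ω → U}
    (hu : u ∈ finiteDecisions T.toEquiv 𝒴 U n) : Measurable u := by
  obtain ⟨m, _, hm⟩ := hu
  exact hm.mono (obsField_le T h𝒴 _) le_rfl

theorem integrable_lossAt_zero (hℓ : Measurable fun p : U × Ω => ℓ p.1 p.2) (hΛ : Integrable Λ μ)
    (hℓΛ : ∀ u ω, |ℓ u ω| ≤ Λ ω) {u : Ω → U} (hu : Measurable u) :
    Integrable (lossAt T.toEquiv ℓ 0 u) μ :=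
  hΛ.mono' (measurable_lossAt T hℓ 0 hu).aestronglyMeasurable
    (Eventually.of_forall fun _ => hℓΛ _ _)

theorem abs_condExp_lossAt_zero_le (hℓ : Measurable fun p : U × Ω => ℓ p.1 p.2)
    (hΛ : Integrable Λ μ) (hℓΛ : ∀ u ω, |ℓ u ω| ≤ Λ ω) {u : Ω → U}
    (hu : Measurable u) :
    ∀ᵐ ω ∂μ, |(μ[lossAt T.toEquiv ℓ 0 u | m]) ω| ≤ (μ[Λ | m]) ω :=
  abs_condExp_le_condExp (integrable_lossAt_zero hℓ hΛ hℓΛ hu) hΛ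
    (Eventually.of_forall fun _ => hℓΛ _ _)

theorem tendsto_integral_of_eLpNorm_one {f : ℕ → Ω → ℝ} (hf : ∀ n, Integrable (f n) μ)
    (h : Tendsto (fun n => eLpNorm (f n) 1 μ) atTop (𝓝 0)) :
    Tendsto (fun n => ∫ ω, f n ω ∂μ) atTop (𝓝 0) := by
  have := tendsto_integral_of_L1' (μ := μ) (l := atTop) (F := f) (fun _ => (0 : ℝ))
    aestronglyMeasurable_const (Eventually.of_forall hf) (h.congr fun n => by
      congr 1
      funext ω
      simp)
  simpa using this

variable [IsProbabilityMeasure μ]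

/-- The losses of an admissible strategy have the same averages as their conditional expectations
given the whole past of the observations. -/
theorem ae_tendsto_cesaro_lossAt_sub_condExp (hT : Ergodic T μ) (h𝒴 : 𝒴 ≤ mΩ)
    (hℓ : Measurable fun p : U × Ω => ℓ p.1 p.2) (hΛ : Integrable Λ μ)
    (hℓΛ : ∀ u ω, |ℓ u ω| ≤ Λ ω) (h𝒳 : 𝒳 ≤ mΩ) (h_gen : 𝒳 ≤ shiftField T.toEquiv 1 𝒳)
    (h_mart₁ : Tendsto (fun n : ℕ => eLpNorm (familyEssSup μ (finiteDecisions T.toEquiv 𝒴 U 0)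
      (fun u ω => |(μ[lossAt T.toEquiv ℓ 0 u | pastField T.toEquiv 𝒴 𝒳 (-(n : ℤ))]) ω
        - lossAt T.toEquiv ℓ 0 u ω|)) 1 μ) atTop (𝓝 0))
    (h_mart₂ : Tendsto (fun n : ℕ => eLpNorm (familyEssSup μ (finiteDecisions T.toEquiv 𝒴 U 0)
      (fun u ω => |(μ[lossAt T.toEquiv ℓ 0 u | pastField T.toEquiv 𝒴 𝒳 (n : ℤ)]) ω
        - (μ[lossAt T.toEquiv ℓ 0 u | remotePastField T.toEquiv 𝒴 𝒳]) ω|)) 1 μ) atTop (𝓝 0))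
    (h_past : ∀ u ∈ finiteDecisions T.toEquiv 𝒴 U 0,
      μ[lossAt T.toEquiv ℓ 0 u | obsField T.toEquiv 𝒴 (Set.Iic 0)]
        =ᵐ[μ] μ[lossAt T.toEquiv ℓ 0 u | remotePastField T.toEquiv 𝒴 𝒳])
    {w : ℕ → Ω → U} (hw : ∀ k, w k ∈ finiteDecisions T.toEquiv 𝒴 U 0) :
    ∀ᵐ ω ∂μ, Tendsto (cesaro fun k => lossAt T.toEquiv ℓ 0 (w k) (T^[k] ω)
      - (μ[lossAt T.toEquiv ℓ 0 (w k) | obsField T.toEquiv 𝒴 (Set.Iic 0)]) (T^[k] ω))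
      atTop (𝓝 0) := by
  have hne : (finiteDecisions T.toEquiv 𝒴 U 0).Nonempty := ⟨_, hw 0⟩
  have hint : ∀ u ∈ finiteDecisions T.toEquiv 𝒴 U 0, Integrable (lossAt T.toEquiv ℓ 0 u) μ :=
    fun u hu => integrable_lossAt_zero hℓ hΛ hℓΛ (measurable_of_mem_finiteDecisions h𝒴 hu)
  have hm : ∀ u ∈ finiteDecisions T.toEquiv 𝒴 U 0, Measurable u :=
    fun u hu => measurable_of_mem_finiteDecisions h𝒴 hu
  let d₁ : ℕ → (Ω → U) → Ω → ℝ := fun n u ω =>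
    |(μ[lossAt T.toEquiv ℓ 0 u | pastField T.toEquiv 𝒴 𝒳 (-(n : ℤ))]) ω
      - lossAt T.toEquiv ℓ 0 u ω|
  let d₂ : ℕ → (Ω → U) → Ω → ℝ := fun n u ω =>
    |(μ[lossAt T.toEquiv ℓ 0 u | pastField T.toEquiv 𝒴 𝒳 (n : ℤ)]) ω
      - (μ[lossAt T.toEquiv ℓ 0 u | remotePastField T.toEquiv 𝒴 𝒳]) ω|
  have hd₁m : ∀ n, ∀ u ∈ finiteDecisions T.toEquiv 𝒴 U 0, AEMeasurable (d₁ n u) μ :=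
    fun n u hu => (integrable_condExp.sub (hint u hu)).abs.aemeasurable
  have hd₂m : ∀ n, ∀ u ∈ finiteDecisions T.toEquiv 𝒴 U 0, AEMeasurable (d₂ n u) μ :=
    fun n u _ => (integrable_condExp.sub integrable_condExp).abs.aemeasurable
  -- These bounds serve only the existence and integrability of the essential suprema; their
  -- smallness comes from the two martingale hypotheses.
  have hd₁b : ∀ n, ∀ u ∈ finiteDecisions T.toEquiv 𝒴 U 0, ∀ᵐ ω ∂μ,
      |d₁ n u ω| ≤ (μ[Λ | pastField T.toEquiv 𝒴 𝒳 (-(n : ℤ))] + Λ) ω := by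
    intro n u hu
    filter_upwards [abs_condExp_lossAt_zero_le hℓ hΛ hℓΛ (hm u hu)] with ω h1
    rw [abs_abs]
    exact (abs_sub _ _).trans (add_le_add h1 (hℓΛ _ _))
  have hd₂b : ∀ n, ∀ u ∈ finiteDecisions T.toEquiv 𝒴 U 0, ∀ᵐ ω ∂μ,
      |d₂ n u ω| ≤ (μ[Λ | pastField T.toEquiv 𝒴 𝒳 (n : ℤ)]
        + μ[Λ | remotePastField T.toEquiv 𝒴 𝒳]) ω := by
    intro n u hu
    filter_upwards [
      abs_condExp_lossAt_zero_le (m := pastField T.toEquiv 𝒴 𝒳 (n : ℤ)) hℓ hΛ hℓΛ (hm u hu),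
      abs_condExp_lossAt_zero_le (m := remotePastField T.toEquiv 𝒴 𝒳) hℓ hΛ hℓΛ (hm u hu)]
      with ω h1 h2
    rw [abs_abs]
    exact (abs_sub _ _).trans (add_le_add h1 h2)
  have hi₁ : ∀ n, Integrable (familyEssSup μ (finiteDecisions T.toEquiv 𝒴 U 0) (d₁ n)) μ :=
    fun n => integrable_familyEssSup hne (hd₁m n) (integrable_condExp.add hΛ) (hd₁b n)
  have hi₂ : ∀ n, Integrable (familyEssSup μ (finiteDecisions T.toEquiv 𝒴 U 0) (d₂ n)) μ :=
    fun n => integrable_familyEssSup hne (hd₂m n) (integrable_condExp.add integrable_condExp)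
      (hd₂b n)
  refine ae_tendsto_cesaro_sub_condExp hT (𝒢 := pastField T.toEquiv 𝒴 𝒳)
    (fun n => pastField_le T h𝒴 h𝒳 n) (pastField_succ_le T.toEquiv h_gen)
    (pastField_le_comap T.toEquiv) (f := fun k => lossAt T.toEquiv ℓ 0 (w k))
    (fun k => (hint _ (hw k)).aestronglyMeasurable) hΛ
    (fun k => Eventually.of_forall fun ω => hℓΛ _ _) hi₁ hi₂
    (tendsto_integral_of_eLpNorm_one hi₁ h_mart₁) (tendsto_integral_of_eLpNorm_one hi₂ h_mart₂)
    (fun n k => le_familyEssSup (hd₁m n) (hd₁b n) (hw k)) fun n k => ?_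
  filter_upwards [le_familyEssSup (hd₂m n) (hd₂b n) (hw k), h_past _ (hw k)] with ω h1 h2
  rw [h2]
  exact h1

theorem comp_zpow_neg_mem_decisions {k : ℕ} {u : Ω → U} (hu : u ∈ decisions T.toEquiv 𝒴 U 0 k) :
    u ∘ ⇑(T.toEquiv ^ (-(k : ℤ))) ∈ decisions T.toEquiv 𝒴 U (-(k : ℤ)) 0 := by
  simpa using comp_zpow_mem_decisions T.toEquiv hu (-(k : ℤ))

/-- A mean-optimal decision at time `k`, seen from time `k`, is nearly optimal among the decisions
based on the last `k + 1` observations. -/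
theorem IsMeanOptimalSelection.condExp_le (hT : MeasurePreserving T μ μ) (h𝒴 : 𝒴 ≤ mΩ)
    (hℓ : Measurable fun p : U × Ω => ℓ p.1 p.2) (hΛ : Integrable Λ μ)
    (hℓΛ : ∀ u ω, |ℓ u ω| ≤ Λ ω) {v : ℕ → Ω → U} (hv : IsMeanOptimalSelection T.toEquiv 𝒴 μ ℓ v)
    {k : ℕ} (hk : 1 ≤ k) {u : Ω → U} (hu : u ∈ decisions T.toEquiv 𝒴 U (-(k : ℤ)) 0) :
    ∀ᵐ ω ∂μ, (μ[lossAt T.toEquiv ℓ 0 (v k ∘ ⇑(T.toEquiv ^ (-(k : ℤ)))) |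
        obsField T.toEquiv 𝒴 (Set.Icc (-(k : ℤ)) 0)]) ω
      ≤ (μ[lossAt T.toEquiv ℓ 0 u | obsField T.toEquiv 𝒴 (Set.Icc (-(k : ℤ)) 0)]) ω
        + 1 / (k : ℝ) := by
  have hint : ∀ w ∈ decisions T.toEquiv 𝒴 U (-(k : ℤ)) 0,
      Integrable (lossAt T.toEquiv ℓ 0 w) μ := fun w hw =>
    integrable_lossAt_zero hℓ hΛ hℓΛ (hw.mono (obsField_le T h𝒴 _) le_rfl)
  have hΛk : Integrable (fun ω => Λ ((T.toEquiv ^ (k : ℤ)) ω)) μ :=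
    (measurePreserving_zpow hT k).integrable_comp_of_integrable hΛ
  have hle : familyEssInf μ (decisions T.toEquiv 𝒴 U 0 k)
      (fun u => μ[lossAt T.toEquiv ℓ k u | obsField T.toEquiv 𝒴 (Set.Icc 0 (k : ℤ))])
      ≤ᵐ[μ] μ[lossAt T.toEquiv ℓ k (u ∘ ⇑(T.toEquiv ^ (k : ℤ))) |
        obsField T.toEquiv 𝒴 (Set.Icc 0 (k : ℤ))] := by
    refine familyEssInf_le
      (f := fun u => μ[lossAt T.toEquiv ℓ k u | obsField T.toEquiv 𝒴 (Set.Icc 0 (k : ℤ))])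
      (H := μ[fun ω => Λ ((T.toEquiv ^ (k : ℤ)) ω) | obsField T.toEquiv 𝒴 (Set.Icc 0 (k : ℤ))])
      (fun w _ => integrable_condExp.aemeasurable) (fun w hw => ?_) ?_
    · refine abs_condExp_le_condExp (hΛk.mono'
        (measurable_lossAt T hℓ k (hw.mono (obsField_le T h𝒴 _) le_rfl)).aestronglyMeasurable
        (Eventually.of_forall fun ω => hℓΛ _ _)) hΛk (Eventually.of_forall fun ω => hℓΛ _ _)
    · simpa using comp_zpow_mem_decisions T.toEquiv hu k
  have h1 := condExp_lossAt_comp_zpow hT h𝒴 k (hint u hu)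
  have h2 := condExp_lossAt_comp_zpow hT h𝒴 k
    (hint _ (comp_zpow_neg_mem_decisions (hv.1 k hk)))
  rw [comp_zpow_neg_comp_zpow] at h2
  -- The inequality is first obtained at the point `T^k ω`; invariance of the measure under `T^{-k}`
  -- then brings it back to `ω`.
  have h3 : ∀ᵐ ω ∂μ, (μ[lossAt T.toEquiv ℓ 0 (v k ∘ ⇑(T.toEquiv ^ (-(k : ℤ)))) |
        obsField T.toEquiv 𝒴 (Set.Icc (-(k : ℤ)) 0)]) ((T.toEquiv ^ (k : ℤ)) ω)
      ≤ (μ[lossAt T.toEquiv ℓ 0 u | obsField T.toEquiv 𝒴 (Set.Icc (-(k : ℤ)) 0)])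
        ((T.toEquiv ^ (k : ℤ)) ω) + 1 / (k : ℝ) := by
    filter_upwards [hle, h1, h2, hv.2 k hk] with ω h4 h5 h6 h7
    rw [← h5, ← h6]
    linarith
  filter_upwards [(measurePreserving_zpow hT (-(k : ℤ))).quasiMeasurePreserving.ae h3] with ω h4
  simpa [zpow_neg] using h4

/-- The conditional risk of a mean-optimal strategy, seen from the present, converges to the
optimal conditional risk given the whole past. -/
theorem IsMeanOptimalSelection.ae_tendsto_condExp (hT : MeasurePreserving T μ μ) (h𝒴 : 𝒴 ≤ mΩ)
    (hℓ : Measurable fun p : U × Ω => ℓ p.1 p.2) (hΛ : Integrable Λ μ)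
    (hℓΛ : ∀ u ω, |ℓ u ω| ≤ Λ ω)
    (h_mart₃ : ∀ᵐ ω ∂μ, Tendsto (fun n : ℕ =>
      familyEssSup μ (decisions T.toEquiv 𝒴 U (-(n : ℤ)) 0) (fun u ω =>
        |(μ[lossAt T.toEquiv ℓ 0 u | obsField T.toEquiv 𝒴 (Set.Icc (-(n : ℤ)) 0)]) ω
          - (μ[lossAt T.toEquiv ℓ 0 u | obsField T.toEquiv 𝒴 (Set.Iic 0)]) ω|) ω) atTop (𝓝 0))
    {v : ℕ → Ω → U} (hv : IsMeanOptimalSelection T.toEquiv 𝒴 μ ℓ v)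
    {w : ℕ → Ω → U} (hw : ∀ k, w k ∈ finiteDecisions T.toEquiv 𝒴 U 0)
    (hwv : ∀ k : ℕ, 1 ≤ k → w k = v k ∘ ⇑(T.toEquiv ^ (-(k : ℤ)))) :
    ∀ᵐ ω ∂μ, Tendsto
      (fun k => (μ[lossAt T.toEquiv ℓ 0 (w k) | obsField T.toEquiv 𝒴 (Set.Iic 0)]) ω) atTop
      (𝓝 (familyEssInf μ (finiteDecisions T.toEquiv 𝒴 U 0)
        (fun u => μ[lossAt T.toEquiv ℓ 0 u | obsField T.toEquiv 𝒴 (Set.Iic 0)]) ω)) := by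
  let D : ℕ → Ω → ℝ := fun n => familyEssSup μ (decisions T.toEquiv 𝒴 U (-(n : ℤ)) 0) (fun u ω =>
    |(μ[lossAt T.toEquiv ℓ 0 u | obsField T.toEquiv 𝒴 (Set.Icc (-(n : ℤ)) 0)]) ω
      - (μ[lossAt T.toEquiv ℓ 0 u | obsField T.toEquiv 𝒴 (Set.Iic 0)]) ω|)
  have hD : ∀ n : ℕ, ∀ u ∈ decisions T.toEquiv 𝒴 U (-(n : ℤ)) 0, ∀ᵐ ω ∂μ,
      |(μ[lossAt T.toEquiv ℓ 0 u | obsField T.toEquiv 𝒴 (Set.Icc (-(n : ℤ)) 0)]) ω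
        - (μ[lossAt T.toEquiv ℓ 0 u | obsField T.toEquiv 𝒴 (Set.Iic 0)]) ω| ≤ D n ω := by
    intro n u hu
    refine le_familyEssSup (S := decisions T.toEquiv 𝒴 U (-(n : ℤ)) 0) (f := fun u ω =>
      |(μ[lossAt T.toEquiv ℓ 0 u | obsField T.toEquiv 𝒴 (Set.Icc (-(n : ℤ)) 0)]) ω
        - (μ[lossAt T.toEquiv ℓ 0 u | obsField T.toEquiv 𝒴 (Set.Iic 0)]) ω|)
      (H := μ[Λ | obsField T.toEquiv 𝒴 (Set.Icc (-(n : ℤ)) 0)]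
        + μ[Λ | obsField T.toEquiv 𝒴 (Set.Iic 0)])
      (fun u _ => (integrable_condExp.sub integrable_condExp).abs.aemeasurable) (fun u hu => ?_) hu
    have hum : Measurable u := hu.mono (obsField_le T h𝒴 _) le_rfl
    filter_upwards [
      abs_condExp_lossAt_zero_le hℓ hΛ hℓΛ (m := obsField T.toEquiv 𝒴 (Set.Icc (-(n : ℤ)) 0)) hum,
      abs_condExp_lossAt_zero_le hℓ hΛ hℓΛ (m := obsField T.toEquiv 𝒴 (Set.Iic 0)) hum]
      with ω h1 h2
    rw [abs_abs]
    exact (abs_sub _ _).trans (add_le_add h1 h2)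
  have hfm : ∀ u ∈ finiteDecisions T.toEquiv 𝒴 U 0,
      AEMeasurable (μ[lossAt T.toEquiv ℓ 0 u | obsField T.toEquiv 𝒴 (Set.Iic 0)]) μ :=
    fun u _ => integrable_condExp.aemeasurable
  have hfb : ∀ u ∈ finiteDecisions T.toEquiv 𝒴 U 0, ∀ᵐ ω ∂μ,
      |(μ[lossAt T.toEquiv ℓ 0 u | obsField T.toEquiv 𝒴 (Set.Iic 0)]) ω|
        ≤ (μ[Λ | obsField T.toEquiv 𝒴 (Set.Iic 0)]) ω := fun u hu =>
    abs_condExp_lossAt_zero_le hℓ hΛ hℓΛ (measurable_of_mem_finiteDecisions h𝒴 hu)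
  -- The field `𝒴_{-k,0}` is exchanged for `𝒴_{-∞,0}` twice, for `w k` and for its competitor, each
  -- at cost `D k`; the selection itself adds `1/k`.
  refine ae_tendsto_familyEssInf ⟨_, hw 0⟩ hfm hfb (δ := fun k ω => 2 * D k ω + 1 / (k : ℝ)) ?_
    (fun k => familyEssInf_le hfm hfb (hw k)) ?_
  · filter_upwards [h_mart₃] with ω hω
    simpa using (hω.const_mul 2).add tendsto_one_div_atTop_nhds_zero_nat
  · rintro u ⟨m, hm0, hm⟩
    -- Once `k ≥ |m|` the competitor belongs to `𝕌_{-k,0}`; `k ≥ 1` is where near-optimality is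
    -- available.
    refine ⟨max 1 m.natAbs, fun k hk => ?_⟩
    have hk1 : 1 ≤ k := (le_max_left _ _).trans hk
    have hkm : -(k : ℤ) ≤ m := by
      have := (le_max_right 1 m.natAbs).trans hk
      omega
    have huk : u ∈ decisions T.toEquiv 𝒴 U (-(k : ℤ)) 0 := decisions_mono _ _ hkm hm
    have hwk := comp_zpow_neg_mem_decisions (hv.1 k hk1)
    rw [hwv k hk1]
    filter_upwards [hD k u huk, hD k _ hwk, hv.condExp_le hT h𝒴 hℓ hΛ hℓΛ hk1 huk]
      with ω h1 h2 h3
    have h4 := (abs_le.1 h1).2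
    have h5 := (abs_le.1 h2).1
    linarith

end Losses

end PathwiseDecision

end

/-! ### Convergence of the loss and pathwise optimality -/

open PathwiseDecision in
theorem mainTheorem2 {Ω U : Type*} (𝒴 𝒳 : MeasurableSpace Ω)
    [ℬ : MeasurableSpace Ω] [MeasurableSpace U]
    (P : Measure Ω) [IsProbabilityMeasure P]
    (T : Ω ≃ᵐ Ω) (hT : Ergodic T P)
    (h𝒴 : 𝒴 ≤ ℬ)
    (ℓ : U → Ω → ℝ) (hℓ : Measurable (fun p : U × Ω => ℓ p.1 p.2))
    (Λ : Ω → ℝ) (hΛ : Integrable Λ P) (hℓΛ : ∀ u ω, |ℓ u ω| ≤ Λ ω)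
    (h𝒳 : 𝒳 ≤ ℬ)
    -- `𝒳 ⊆ T⁻¹ 𝒳`
    (h_gen : 𝒳 ≤ PathwiseDecision.shiftField T.toEquiv 1 𝒳)
    -- the three martingales converge uniformly: the first two in `L¹`, the third almost surely
    (h_mart₁ : Tendsto (fun n : ℕ => eLpNorm
        (PathwiseDecision.familyEssSup P (PathwiseDecision.finiteDecisions T.toEquiv 𝒴 U 0)
          (fun u ω =>
            |(P[PathwiseDecision.lossAt T.toEquiv ℓ 0 u |
                PathwiseDecision.pastField T.toEquiv 𝒴 𝒳 (-(n : ℤ))]) ω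
              - PathwiseDecision.lossAt T.toEquiv ℓ 0 u ω|)) 1 P) atTop (𝓝 0))
    (h_mart₂ : Tendsto (fun n : ℕ => eLpNorm
        (PathwiseDecision.familyEssSup P (PathwiseDecision.finiteDecisions T.toEquiv 𝒴 U 0)
          (fun u ω =>
            |(P[PathwiseDecision.lossAt T.toEquiv ℓ 0 u |
                PathwiseDecision.pastField T.toEquiv 𝒴 𝒳 (n : ℤ)]) ω
              - (P[PathwiseDecision.lossAt T.toEquiv ℓ 0 u |
                PathwiseDecision.remotePastField T.toEquiv 𝒴 𝒳]) ω|)) 1 P) atTop (𝓝 0))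
    (h_mart₃ : ∀ᵐ ω ∂P, Tendsto (fun n : ℕ =>
        PathwiseDecision.familyEssSup P (PathwiseDecision.decisions T.toEquiv 𝒴 U (-(n : ℤ)) 0)
          (fun u ω =>
            |(P[PathwiseDecision.lossAt T.toEquiv ℓ 0 u |
                PathwiseDecision.obsField T.toEquiv 𝒴 (Set.Icc (-(n : ℤ)) 0)]) ω
              - (P[PathwiseDecision.lossAt T.toEquiv ℓ 0 u |
                PathwiseDecision.obsField T.toEquiv 𝒴 (Set.Iic 0)]) ω|) ω) atTop (𝓝 0))
    -- the remote past does not affect the present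
    (h_past : ∀ u ∈ PathwiseDecision.finiteDecisions T.toEquiv 𝒴 U 0,
      P[PathwiseDecision.lossAt T.toEquiv ℓ 0 u | PathwiseDecision.obsField T.toEquiv 𝒴 (Set.Iic 0)]
        =ᵐ[P] P[PathwiseDecision.lossAt T.toEquiv ℓ 0 u |
          PathwiseDecision.remotePastField T.toEquiv 𝒴 𝒳])
    (v : ℕ → Ω → U) (hv : PathwiseDecision.IsMeanOptimalSelection T.toEquiv 𝒴 P ℓ v) :
    (∀ᵐ ω ∂P, Tendsto (fun N : ℕ => PathwiseDecision.avgLoss T.toEquiv ℓ v N ω) atTop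
        (𝓝 (PathwiseDecision.optimalLoss T.toEquiv 𝒴 P ℓ))) ∧
      PathwiseDecision.IsPathwiseOptimal T.toEquiv 𝒴 P ℓ v := by
  have hTp := hT.toMeasurePreserving
  let a : (Ω → U) → Ω → ℝ := fun u => P[lossAt T.toEquiv ℓ 0 u | obsField T.toEquiv 𝒴 (Set.Iic 0)]
  let F : Ω → ℝ := familyEssInf P (finiteDecisions T.toEquiv 𝒴 U 0) a
  -- the decisions of an admissible strategy, seen from the times at which they are made
  let w : (ℕ → Ω → U) → ℕ → Ω → U := fun u k =>
    u (max 1 k) ∘ ⇑(T.toEquiv ^ (-((max 1 k : ℕ) : ℤ)))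
  -- The index `max 1 k` replaces the unconstrained entry `u 0` by `u 1`, so that every `w u k` is a
  -- genuine decision; averages ignore `k = 0`.
  have hw : ∀ u, IsAdmissible T.toEquiv 𝒴 u → ∀ k, w u k ∈ finiteDecisions T.toEquiv 𝒴 U 0 :=
    fun u hu k => ⟨_, by simp, comp_zpow_neg_mem_decisions (hu _ (le_max_left 1 k))⟩
  have hw' : ∀ u (k : ℕ), 1 ≤ k → w u k = u k ∘ ⇑(T.toEquiv ^ (-(k : ℤ))) := by
    intro u k hk
    simp only [w, max_eq_right hk]
  have ham : ∀ u ∈ finiteDecisions T.toEquiv 𝒴 U 0, AEMeasurable (a u) P :=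
    fun u _ => integrable_condExp.aemeasurable
  have hab : ∀ u ∈ finiteDecisions T.toEquiv 𝒴 U 0, ∀ᵐ ω ∂P,
      |a u ω| ≤ (P[Λ | obsField T.toEquiv 𝒴 (Set.Iic 0)]) ω := fun u hu =>
    abs_condExp_lossAt_zero_le hℓ hΛ hℓΛ (measurable_of_mem_finiteDecisions h𝒴 hu)
  have hne : (finiteDecisions T.toEquiv 𝒴 U 0).Nonempty := ⟨_, hw v hv.1 0⟩
  have hFi : Integrable F P := integrable_familyEssInf hne ham integrable_condExp hab
  have hF : ∀ᵐ ω ∂P, Tendsto (cesaro fun k => F (T^[k] ω)) atTop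
      (𝓝 (optimalLoss T.toEquiv 𝒴 P ℓ)) := ae_tendsto_cesaro_ergodic hT hFi
  have hsplit : ∀ (u : ℕ → Ω → U) (N : ℕ) (ω : Ω), avgLoss T.toEquiv ℓ u N ω =
      cesaro (fun k => lossAt T.toEquiv ℓ 0 (w u k) (T^[k] ω) - a (w u k) (T^[k] ω)) N
        + cesaro (fun k => a (w u k) (T^[k] ω)) N := by
    intro u N ω
    rw [← cesaro_add]
    refine cesaro_congr (x := fun k : ℕ => lossAt T.toEquiv ℓ k (u k) ω) (fun k hk => ?_) N
    rw [lossAt_eq_comp_iterate, hw' u k hk, sub_add_cancel]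
  have hlln : ∀ u, IsAdmissible T.toEquiv 𝒴 u → ∀ᵐ ω ∂P, Tendsto
      (cesaro fun k => lossAt T.toEquiv ℓ 0 (w u k) (T^[k] ω) - a (w u k) (T^[k] ω))
      atTop (𝓝 0) := fun u hu =>
    ae_tendsto_cesaro_lossAt_sub_condExp hT h𝒴 hℓ hΛ hℓΛ h𝒳 h_gen h_mart₁ h_mart₂ h_past (hw u hu)
  -- The function `a (w v k)` changes with `k`, so the plain ergodic theorem does not apply;
  -- domination and almost sure convergence to `F` suffice.
  have hmaker : ∀ᵐ ω ∂P,
      Tendsto (cesaro fun k => a (w v k) (T^[k] ω) - F (T^[k] ω)) atTop (𝓝 0) := by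
    refine ae_tendsto_cesaro_of_dominated hT (e := fun k ω => a (w v k) ω - F ω)
      (G := fun ω => 2 * (P[Λ | obsField T.toEquiv 𝒴 (Set.Iic 0)]) ω)
      (fun k => (ham _ (hw v hv.1 k)).sub hFi.aemeasurable) (integrable_condExp.const_mul 2)
      (fun k _ => ?_) ?_
    · filter_upwards [hab _ (hw v hv.1 k),
        abs_familyEssInf_le hne ham integrable_condExp.aemeasurable hab] with ω h1 h2
      rw [two_mul]
      exact (abs_sub _ _).trans (add_le_add h1 h2)
    · filter_upwards [hv.ae_tendsto_condExp hTp h𝒴 hℓ hΛ hℓΛ h_mart₃ (hw v hv.1) (hw' v)]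
        with ω hω
      rw [← sub_self (F ω)]
      exact hω.sub_const (F ω)
  have hconv : ∀ᵐ ω ∂P, Tendsto (fun N : ℕ => avgLoss T.toEquiv ℓ v N ω) atTop
      (𝓝 (optimalLoss T.toEquiv 𝒴 P ℓ)) := by
    filter_upwards [hlln v hv.1, hmaker, hF] with ω h1 h2 h3
    have h4 := h1.add (h2.add h3)
    rw [zero_add, zero_add] at h4
    refine h4.congr fun N => ?_
    rw [hsplit, cesaro_sub (fun k => a (w v k) (T^[k] ω)), sub_add_cancel]
  refine ⟨hconv, hv.1, fun u hu => ?_⟩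
  have hFa : ∀ᵐ ω ∂P, ∀ k : ℕ, F (T^[k] ω) ≤ a (w u k) (T^[k] ω) := ae_all_iff.2 fun k =>
    (hTp.iterate k).quasiMeasurePreserving.ae (familyEssInf_le ham hab (hw u hu k))
  -- Replacing `a (w u k)` by the smaller `F` gives a minorant of `L_N(𝐮) - L_N(𝐯)` that tends to `0
  -- + L^* - L^* = 0`. In `EReal` its liminf compares without boundedness conditions.
  filter_upwards [hlln u hu, hF, hconv, hFa] with ω h1 h2 h3 h4
  have h5 := (h1.add h2).sub h3
  rw [zero_add, sub_self] at h5
  have h6 := (continuous_coe_real_ereal.tendsto (0 : ℝ)).comp h5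
  rw [EReal.coe_zero] at h6
  rw [← h6.liminf_eq]
  refine liminf_le_liminf (Eventually.of_forall fun N => ?_)
  rw [hsplit u]
  exact EReal.coe_le_coe_iff.2
    (sub_le_sub_right (add_le_add le_rfl (cesaro_mono (fun k _ => h4 k) N)) _)
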